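/- **Setting.** Let $K$ be a linearly ordered ring, for instance $\mathbb Z$, $\mathbb Q$ or $\mathbb R$. The data types are the agent names $\langle\mathbb A,\{=\}\rangle$ and the specification names $\langle\mathbb B,\{=\}\rangle$ (both infinite sets of pure names), which every system has, and one further data type $\langle K,\{<,=,\mathsf{succ}\}\rangle$ with the successor relation $\mathsf{succ}(x,y)\Leftrightarrow x=y+1$. A *facet* is a data type with a quantifier-free formula in one variable over the relations of the type; a *base facet* has the formula $\mathsf{true}$. A *relational multiagent system* (RMAS) $\mathcal X$ consists of finitely many facets, a finite initial data domain (whose numeric elements are integers, and which contains all constants mentioned in $\mathcal X$), facet-typed services, message relations and agent specifications, among them that of the institutional agent $\mathsf{inst}$. An agent specification has a name; a facet-typed relational schema; a finite set of first-order constraints over the schema and the relations of the data types; an initial database that satisfies them; communicative rules "$Q(t,\vec x)$ enables $M(\vec x)$ to $t$"; update actions, given by parallel effects "$Q \rightsquigarrow$ add $A$, del $D$", whose added facts may contain service calls; and update rules "on $M(\vec x)$ to $t$ (or from $s$) if $Q$ then $\alpha$". All rules are well-typed, and the constraints and the queries of communicative rules and effects are domain independent. Every agent has the relation $\mathit{MyName}/1$,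 and $\mathsf{inst}$ has the registry relations $\mathit{Agent}/1$, $\mathit{Spec}/1$, $\mathit{hasSpec}/2$, in which it is itself registered. In the transition system $\Upsilon_{\mathcal X}$ a state assigns a database to each active agent (the active agents are those registered in $\mathit{hasSpec}$ at $\mathsf{inst}$). In a step, an active agent sends an enabled message to an active agent; the triggered actions of both are applied in parallel, with priority to additions; every service call that occurs is replaced by an arbitrary object of its output facet; and each of the two agents keeps its old database if the new one violates its schema or its constraints. $\mathcal X$ is *state-bounded* by $b$ if in every state of $\Upsilon_{\mathcal X}$ each agent database contains at most $b$ data objects, and *shallow-typed* if it uses base facets only. **Theorem.** Verification of a propositional reachability property over state-bounded, shallow-typed RMASs that use a single data type equipped with the successor relation is undecidable, even when the RMAS contains a single agent that uses unary relations only. That is, let $p$ be a relation name other than $\mathit{MyName}$, $\mathit{Agent}$, $\mathit{Spec}$, $\mathit{hasSpec}$. There is no algorithm that decides, given an RMAS $\mathcal X$ over the above data types and a number $b$ such that - $\mathcal X$ is well-formed, shallow-typed and state-bounded by $b$, - the specification of $\mathsf{inst}$ is the only agent specification, and in every state of $\Upsilon_{\mathcal X}$ the agent $\mathsf{inst}$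 is the only active agent, and is registered with its own specification only, - all messages, and all relations of $\mathsf{inst}$ other than the obligatory $\mathit{hasSpec}/2$, have arity at most one, - $p$ is a proposition ($0$-ary relation) in the schema of $\mathsf{inst}$, whether $\Upsilon_{\mathcal X}\models\mu Z.(p@\mathsf{inst}\vee\langle-\rangle Z)$, i.e. whether a state in which $p$ holds in the database of $\mathsf{inst}$ is reachable. This is so even if the algorithm need not terminate on inputs that are not of this kind. -/

import Mathlib

/-! # Relational multiagent systems (RMASs) over the data types of agent names, of specification
names, and of one numeric type equipped with `<`, `=` and the successor relation -/

namespace Rmas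

/-! ## Data types, data objects, facets -/

/-- The three data types: agent names `⟨𝔸, {=}⟩`, specification names `⟨𝔹, {=}⟩`, and the numeric
type `⟨K, {<, =, succ}⟩`. -/
inductive Ty where
  | agent | spec | num

/-- Data objects: the disjoint union of the three data domains. Agent names and specification names
are pure names, drawn from a countably infinite set. -/
inductive Obj (K : Type*) where
  | agent (n : ℕ)
  | spec (n : ℕ)
  | num (k : K)

/-- The data type to which a data object belongs. -/
def Obj.ty {K : Type*} : Obj K → Ty
  | .agent _ => .agent
  | .spec _ => .spec
  | .num _ => .num

/-- Finitely representable data objects, which may be mentioned in a specification. -/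
abbrev Const := Obj ℤ

/-- The data object denoted by a constant. -/
def Const.den (K : Type*) [Ring K] : Const → Obj K
  | .agent n => .agent n
  | .spec n => .spec n
  | .num z => .num (z : K)

/-- The domain-specific (rigid, binary) relations. -/
inductive DRel where
  | eq | lt | succ

/-- The data types that are equipped with a given domain-specific relation. -/
def DRel.On : DRel → Ty → Prop
  | .eq, _ => True
  | .lt, T => T = .num
  | .succ, T => T = .num

/-- Interpretation of the domain-specific relations; `succ(x, y)` says that `x` is the successor
of `y`. -/
def DRel.Holds {K : Type*} [Ring K] [LinearOrder K] : DRel → Obj K → Obj K → Prop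
  | .eq, x, y => x = y
  | .lt, .num x, .num y => x < y
  | .succ, .num x, .num y => x = y + 1
  | _, _, _ => False

/-- Facet formulae over the single variable `x`. A term is `none` (the variable) or `some c`. -/
inductive FacetForm where
  | tt
  | atom (r : DRel) (t u : Option Const)
  | neg (φ : FacetForm)
  | or (φ ψ : FacetForm)

/-- `φ` holds under the substitution of `o` for the variable. -/
def FacetForm.Sat {K : Type*} [Ring K] [LinearOrder K] (o : Obj K) : FacetForm → Prop
  | .tt => True
  | .atom r t u => r.Holds (t.elim o (Const.den K)) (u.elim o (Const.den K))
  | .neg φ => ¬ φ.Sat o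
  | .or φ ψ => φ.Sat o ∨ ψ.Sat o

/-- A facet: a data type together with a facet formula. -/
structure Facet where
  ty : Ty
  cond : FacetForm

/-- The data object `o` belongs to the facet. -/
def Facet.Mem {K : Type*} [Ring K] [LinearOrder K] (F : Facet) (o : Obj K) : Prop :=
  o.ty = F.ty ∧ F.cond.Sat o

/-- The facet formula only uses relations of the data type `T`, and objects of `T` that are
listed in `Δ₀`. -/
def FacetForm.Wf (Δ₀ : List Const) (T : Ty) : FacetForm → Prop
  | .tt => True
  | .atom r t u => r.On T ∧ ∀ c : Const, (t = some c ∨ u = some c) → c.ty = T ∧ c ∈ Δ₀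
  | .neg φ => φ.Wf Δ₀ T
  | .or φ ψ => φ.Wf Δ₀ T ∧ ψ.Wf Δ₀ T

/-- The base facet of agent names. -/
def AF : Facet := ⟨.agent, .tt⟩

/-- The base facet of specification names. -/
def BF : Facet := ⟨.spec, .tt⟩

/-! ## Relation schemas, services, queries -/

/-- A typed relation schema (also used for messages); the arity is the length of `types`. -/
structure RelSchema where
  name : ℕ
  types : List Facet

/-- A typed service. -/
structure Service where
  name : ℕ
  input : List Facet
  output : Facet

/-- Typed (sorted) variables. -/
inductive Var where
  | agent (n : ℕ)
  | spec (n : ℕ)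
  | num (n : ℕ)
  deriving DecidableEq

/-- The data type of a variable. -/
def Var.ty : Var → Ty
  | .agent _ => .agent
  | .spec _ => .spec
  | .num _ => .num

inductive Term where
  | var (x : Var)
  | const (c : Const)

def Term.ty : Term → Ty
  | .var x => x.ty
  | .const c => c.ty

def Term.eval {K : Type*} [Ring K] (v : Var → Obj K) : Term → Obj K
  | .var x => v x
  | .const c => c.den K

/-- First-order queries over a database schema and the domain-specific relations. -/
inductive Query where
  | tt
  | rel (R : ℕ) (ts : List Term)
  | drel (r : DRel) (t u : Term)
  | neg (q : Query)
  | and (q r : Query)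
  | ex (x : Var) (q : Query)

/-- Free variables. -/
def Query.fv : Query → Set Var
  | .tt => ∅
  | .rel _ ts => {x | Term.var x ∈ ts}
  | .drel _ t u => {x | t = .var x ∨ u = .var x}
  | .neg q => q.fv
  | .and q r => q.fv ∪ r.fv
  | .ex x q => q.fv \ {x}

/-- Constants mentioned in a query. -/
def Query.consts : Query → Set Const
  | .tt => ∅
  | .rel _ ts => {c | Term.const c ∈ ts}
  | .drel _ t u => {c | t = .const c ∨ u = .const c}
  | .neg q => q.consts
  | .and q r => q.consts ∪ r.consts
  | .ex _ q => q.consts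

/-- Ground facts `R(o₁, …, oₙ)`. -/
abbrev Fact (K : Type*) := ℕ × List (Obj K)

/-- Database instances. -/
abbrev Instance (K : Type*) := Set (Fact K)

/-- The valuation maps each variable to an object of the data type of the variable. -/
def Typed {K : Type*} (v : Var → Obj K) : Prop := ∀ x, (v x).ty = x.ty

/-- First-order semantics; the quantifier `∃ x` ranges over those objects of the data type of `x`
that lie in `U`. -/
def Query.SatIn {K : Type*} [Ring K] [LinearOrder K] (U : Set (Obj K)) (D : Instance K) :
    (Var → Obj K) → Query → Prop
  | _, .tt => True
  | v, .rel R ts => (R, ts.map (Term.eval v)) ∈ D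
  | v, .drel r t u => r.Holds (t.eval v) (u.eval v)
  | v, .neg q => ¬ q.SatIn U D v
  | v, .and q r => q.SatIn U D v ∧ r.SatIn U D v
  | v, .ex x q => ∃ o ∈ U, o.ty = x.ty ∧ q.SatIn U D (Function.update v x o)

/-- First-order semantics over the full data domains. -/
def Query.Sat {K : Type*} [Ring K] [LinearOrder K] (D : Instance K) (v : Var → Obj K)
    (q : Query) : Prop := q.SatIn Set.univ D v

/-- The active domain of a database instance. -/
def adom {K : Type*} (D : Instance K) : Set (Obj K) := {o | ∃ f ∈ D, o ∈ f.2}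

/-- The fact conforms to one of the typed relation schemas. -/
def FactConforms {K : Type*} [Ring K] [LinearOrder K] (𝒟 : List RelSchema) (f : Fact K) : Prop :=
  ∃ r ∈ 𝒟, r.name = f.1 ∧ List.Forall₂ Facet.Mem r.types f.2

/-- The instance conforms to the database schema. -/
def Conforms {K : Type*} [Ring K] [LinearOrder K] (𝒟 : List RelSchema) (D : Instance K) : Prop :=
  ∀ f ∈ D, FactConforms 𝒟 f

/-- Domain independence: over every (finite) instance `D` of the schema, the answers computed
with respect to any domain `U` that contains the active domain of `D` and the constants of the query
are the answers computed with respect to the full domains. -/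
def Query.DomIndep (K : Type*) [Ring K] [LinearOrder K] (𝒟 : List RelSchema) (q : Query) : Prop :=
  ∀ D : Instance K, D.Finite → Conforms 𝒟 D →
    ∀ U : Set (Obj K), adom D ⊆ U → (∀ c ∈ q.consts, c.den K ∈ U) →
      ∀ v : Var → Obj K, Typed v →
        (q.Sat D v ↔ (∀ x ∈ q.fv, v x ∈ U) ∧ q.SatIn U D v)

/-- The term is of the type of the facet, and is a variable or an initial data object. -/
def Term.Fits (Δ₀ : List Const) (F : Facet) (t : Term) : Prop :=
  t.ty = F.ty ∧ ∀ c, t = .const c → c ∈ Δ₀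

/-- Compatibility of a query with a database schema: atoms use relations of the schema, terms have
the types of the components in which they occur, and constants are initial data objects. -/
def Query.Compatible (Δ₀ : List Const) (𝒟 : List RelSchema) : Query → Prop
  | .tt => True
  | .rel R ts => ∃ r ∈ 𝒟, r.name = R ∧ List.Forall₂ (Term.Fits Δ₀) r.types ts
  | .drel r t u => t.ty = u.ty ∧ r.On t.ty ∧ ∀ c, (t = .const c ∨ u = .const c) → c ∈ Δ₀
  | .neg q => q.Compatible Δ₀ 𝒟
  | .and q r => q.Compatible Δ₀ 𝒟 ∧ r.Compatible Δ₀ 𝒟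
  | .ex _ q => q.Compatible Δ₀ 𝒟

/-! ## Agent specifications and RMASs -/

/-- Terms of an "add" fact: ordinary terms, or service calls `f(y₁, …, yₖ)`. -/
inductive AddTerm where
  | term (t : Term)
  | call (f : ℕ) (ys : List Var)

/-- The update effect `query ⇝ add, del`. -/
structure Effect where
  query : Query
  add : List (ℕ × List AddTerm)
  del : List (ℕ × List Term)

/-- An update action, with its typed parameters and its effects. -/
structure Action where
  name : ℕ
  params : List (Var × Facet)
  effects : List Effect

/-- The communicative rule `query enables msg(payload) to target`. -/
structure CommRule where
  query : Query
  msg : ℕ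
  payload : List Var
  target : Var

/-- The update rule `on msg(payload) to peer if cond then action(args)` (when `onSend = true`) or
`on msg(payload) from peer if cond then action(args)` (when `onSend = false`). -/
structure UpdateRule where
  onSend : Bool
  msg : ℕ
  payload : List Var
  peer : Var
  cond : Query
  action : ℕ
  args : List Term

/-- Agent specifications `⟨n, 𝒟, Γ, D₀, 𝒞, 𝒜, 𝒰⟩`. -/
structure AgentSpec where
  name : ℕ
  schema : List RelSchema
  constraints : List Query
  initDb : List (ℕ × List Const)
  comm : List CommRule
  actions : List Action
  updates : List UpdateRule

end Rmas

open Rmas in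
/-- A relational multiagent system: facets, initial data domain, services, messages, agent
specifications, and the specification of the institutional agent. -/
structure RMAS where
  facets : List Facet
  initDom : List Const
  services : List Service
  messages : List RelSchema
  specs : List AgentSpec
  inst : AgentSpec

namespace Rmas

/-! ### Reserved names -/

/-- The name of the institutional agent. -/
def instName : ℕ := 0
/-- The name of the specification of the institutional agent. -/
def ispecName : ℕ := 0
/-- The relation `MyName/1`. -/
def rMyName : ℕ := 0
/-- The relation `Agent/1`. -/
def rAgent : ℕ := 1
/-- The relation `Spec/1`. -/
def rSpec : ℕ := 2
/-- The relation `hasSpec/2`. -/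
def rHasSpec : ℕ := 3

/-- The fact `hasSpec(n, m)`. -/
def hasSpecFact (K : Type*) (n m : ℕ) : Fact K := (rHasSpec, [.agent n, .spec m])

/-- The initial database of a specification. -/
def AgentSpec.initial (K : Type*) [Ring K] (S : AgentSpec) : Instance K :=
  {f | ∃ g ∈ S.initDb, f = (g.1, g.2.map (Const.den K))}

end Rmas

namespace RMAS

open Rmas

/-- All the specifications of the system, the institutional one included. -/
def allSpecs (X : RMAS) : List AgentSpec := X.inst :: X.specs

/-! ## Well-formedness -/

/-- Typed relation schemas over the facets of `X`, with pairwise distinct names. -/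
def WfSchema (X : RMAS) (𝒟 : List RelSchema) : Prop :=
  (𝒟.map RelSchema.name).Nodup ∧ ∀ r ∈ 𝒟, ∀ F ∈ r.types, F ∈ X.facets

/-- Well-formed communicative rules. -/
def WfComm (X : RMAS) (K : Type*) [Ring K] [LinearOrder K] (S : AgentSpec) (c : CommRule) : Prop :=
  c.query.Compatible X.initDom S.schema ∧ c.query.DomIndep K S.schema ∧
  c.query.fv = {x | x = c.target ∨ x ∈ c.payload} ∧
  c.target.ty = .agent ∧
  ∃ m ∈ X.messages, m.name = c.msg ∧ List.Forall₂ (fun F x => Var.ty x = F.ty) m.types c.payload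

/-- The term of an "add" fact is of the type of the facet, and a service call is well-typed. -/
def AddTermFits (X : RMAS) (F : Facet) : AddTerm → Prop
  | .term t => t.Fits X.initDom F
  | .call f ys => ∃ g ∈ X.services, g.name = f ∧
      List.Forall₂ (fun G y => Var.ty y = G.ty) g.input ys ∧ g.output.ty = F.ty

/-- Well-formed effects of an action; facts use only free variables of the query and parameters. -/
def WfEffect (X : RMAS) (K : Type*) [Ring K] [LinearOrder K] (S : AgentSpec) (α : Action)
    (e : Effect) : Prop :=
  e.query.Compatible X.initDom S.schema ∧ e.query.DomIndep K S.schema ∧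
  (∀ d ∈ e.del,
    (∃ r ∈ S.schema, r.name = d.1 ∧ List.Forall₂ (Term.Fits X.initDom) r.types d.2) ∧
    ∀ x, Term.var x ∈ d.2 → x ∈ e.query.fv ∨ x ∈ α.params.map Prod.fst) ∧
  (∀ d ∈ e.add,
    (∃ r ∈ S.schema, r.name = d.1 ∧ List.Forall₂ X.AddTermFits r.types d.2) ∧
    ∀ x, (AddTerm.term (.var x) ∈ d.2 ∨ ∃ f ys, AddTerm.call f ys ∈ d.2 ∧ x ∈ ys) →
      x ∈ e.query.fv ∨ x ∈ α.params.map Prod.fst)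

/-- Well-formed actions. -/
def WfAction (X : RMAS) (K : Type*) [Ring K] [LinearOrder K] (S : AgentSpec) (α : Action) : Prop :=
  (α.params.map Prod.fst).Nodup ∧
  (∀ p ∈ α.params, p.1.ty = p.2.ty ∧ p.2 ∈ X.facets) ∧
  ∀ e ∈ α.effects, X.WfEffect K S α e

/-- Well-formed update rules. -/
def WfUpdate (X : RMAS) (S : AgentSpec) (u : UpdateRule) : Prop :=
  (u.peer :: u.payload).Nodup ∧ u.peer.ty = .agent ∧
  (∃ m ∈ X.messages, m.name = u.msg ∧
    List.Forall₂ (fun F x => Var.ty x = F.ty) m.types u.payload) ∧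
  u.cond.Compatible X.initDom S.schema ∧
  (∀ x ∈ u.cond.fv, x ∈ u.peer :: u.payload) ∧
  (∃ α ∈ S.actions, α.name = u.action ∧
    List.Forall₂ (fun p t => Term.Fits X.initDom p.2 t) α.params u.args) ∧
  ∀ x, Term.var x ∈ u.args → x ∈ u.peer :: u.payload

/-- Well-formed agent specifications. -/
def WfSpec (X : RMAS) (K : Type*) [Ring K] [LinearOrder K] (S : AgentSpec) : Prop :=
  (.spec S.name ∈ X.initDom) ∧
  X.WfSchema S.schema ∧ (⟨rMyName, [AF]⟩ ∈ S.schema) ∧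
  (∀ q ∈ S.constraints,
    q.fv = ∅ ∧ q.Compatible X.initDom S.schema ∧ q.DomIndep K S.schema) ∧
  Conforms S.schema (S.initial K) ∧
  (∀ q ∈ S.constraints, ∀ v : Var → Obj K, Typed v → q.Sat (S.initial K) v) ∧
  (∀ f ∈ S.initDb, ∀ c ∈ f.2, c ∈ X.initDom) ∧
  (∀ c ∈ S.comm, X.WfComm K S c) ∧
  (S.actions.map Action.name).Nodup ∧ (∀ α ∈ S.actions, X.WfAction K S α) ∧
  ∀ u ∈ S.updates, X.WfUpdate S u

/-- Well-formed RMASs, including the requirements on the institutional agent. -/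
def WellFormed (X : RMAS) (K : Type*) [Ring K] [LinearOrder K] : Prop :=
  (∀ F ∈ X.facets, F.cond.Wf X.initDom F.ty) ∧
  (X.services.map Service.name).Nodup ∧
  (∀ f ∈ X.services, f.output ∈ X.facets ∧ ∀ F ∈ f.input, F ∈ X.facets) ∧
  X.WfSchema X.messages ∧
  (X.allSpecs.map AgentSpec.name).Nodup ∧
  (∀ S ∈ X.allSpecs, X.WfSpec K S) ∧
  X.inst.name = ispecName ∧
  (⟨rAgent, [AF]⟩ ∈ X.inst.schema) ∧
  (⟨rSpec, [BF]⟩ ∈ X.inst.schema) ∧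
  (⟨rHasSpec, [AF, BF]⟩ ∈ X.inst.schema) ∧
  ((rAgent, [.agent instName]) ∈ X.inst.initDb) ∧
  (∀ S ∈ X.allSpecs, (rSpec, [.spec S.name]) ∈ X.inst.initDb) ∧
  ((rHasSpec, [.agent instName, .spec ispecName]) ∈ X.inst.initDb)

end RMAS

namespace Rmas

/-! ## Execution semantics -/

/-- A state assigns a database to each active agent, and `none` to the other agent names. -/
abbrev State (K : Type*) := ℕ → Option (Instance K)

/-- The pairs of an agent name and a specification name recorded by `hasSpec` in a database. -/
def registryOf {K : Type*} (D : Instance K) : Set (ℕ × ℕ) := {p | hasSpecFact K p.1 p.2 ∈ D}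

/-- The currently active agents with their specifications, read off the database of the
institutional agent. -/
def curAS {K : Type*} (s : State K) : Set (ℕ × ℕ) := {p | ∃ D, s instName = some D ∧ p ∈ registryOf D}

/-- Ground service calls. -/
abbrev GCall (K : Type*) := ℕ × List (Obj K)

/-- Ground terms: data objects or ground service calls. -/
inductive GTerm (K : Type*) where
  | obj (o : Obj K)
  | call (c : GCall K)

/-- Ground facts that may contain service calls. -/
abbrev PFact (K : Type*) := ℕ × List (GTerm K)

def AddTerm.ground {K : Type*} [Ring K] (v : Var → Obj K) : AddTerm → GTerm K
  | .term t => .obj (t.eval v)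
  | .call f ys => .call (f, ys.map v)

/-- Replacement of service calls by their results. -/
def GTerm.subst {K : Type*} (θ : GCall K → Obj K) : GTerm K → Obj K
  | .obj o => o
  | .call c => θ c

/-- The enabled messages with payload and target: answers to communicative rules whose payload
conforms to the message schema. -/
def enabledMsgs (X : RMAS) {K : Type*} [Ring K] [LinearOrder K] (S : AgentSpec) (D : Instance K) :
    Set (Fact K × ℕ) :=
  {p | ∃ c ∈ S.comm, ∃ v : Var → Obj K, Typed v ∧ c.query.Sat D v ∧
    v c.target = .agent p.2 ∧ p.1 = (c.msg, c.payload.map v) ∧ FactConforms X.messages p.1}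

/-- The instantiated actions triggered by the update rules (on-send or on-receive) that match the
message `M` exchanged with the agent `peer`. -/
def triggered {K : Type*} [Ring K] [LinearOrder K] (S : AgentSpec) (D : Instance K)
    (onSend : Bool) (M : Fact K) (peer : ℕ) : Set (Action × List (Obj K)) :=
  {p | ∃ u ∈ S.updates, u.onSend = onSend ∧ u.msg = M.1 ∧
    ∃ v : Var → Obj K, Typed v ∧ u.payload.map v = M.2 ∧ v u.peer = .agent peer ∧
      u.cond.Sat D v ∧ p.1 ∈ S.actions ∧ p.1.name = u.action ∧ p.2 = u.args.map (Term.eval v) ∧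
      List.Forall₂ (fun q o => Facet.Mem q.2 o) p.1.params p.2}

/-- The facts to be deleted by a set of instantiated actions. -/
def toDel {K : Type*} [Ring K] [LinearOrder K] (D : Instance K)
    (acts : Set (Action × List (Obj K))) : Set (Fact K) :=
  {f | ∃ p ∈ acts, ∃ e ∈ p.1.effects, ∃ v : Var → Obj K, Typed v ∧
    p.1.params.map (fun q => v q.1) = p.2 ∧ e.query.Sat D v ∧
    ∃ d ∈ e.del, f = (d.1, d.2.map (Term.eval v))}

/-- The facts to be added by a set of instantiated actions, with embedded service calls. -/
def toAdd {K : Type*} [Ring K] [LinearOrder K] (D : Instance K)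
    (acts : Set (Action × List (Obj K))) : Set (PFact K) :=
  {f | ∃ p ∈ acts, ∃ e ∈ p.1.effects, ∃ v : Var → Obj K, Typed v ∧
    p.1.params.map (fun q => v q.1) = p.2 ∧ e.query.Sat D v ∧
    ∃ d ∈ e.add, f = (d.1, d.2.map (AddTerm.ground v))}

/-- The new database, with service calls still to be issued: deletions, then additions. -/
def pending {K : Type*} [Ring K] [LinearOrder K] (D : Instance K)
    (acts : Set (Action × List (Obj K))) : Set (PFact K) :=
  {f | ∃ g ∈ D \ toDel D acts, f = (g.1, g.2.map GTerm.obj)} ∪ toAdd D acts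

/-- The ground service calls contained in a set of facts. -/
def calls {K : Type*} (P : Set (PFact K)) : Set (GCall K) := {c | ∃ f ∈ P, GTerm.call c ∈ f.2}

/-- The database obtained by substituting the results of the service calls. -/
def substDb {K : Type*} (θ : GCall K → Obj K) (P : Set (PFact K)) : Instance K :=
  {f | ∃ g ∈ P, f = (g.1, g.2.map (GTerm.subst θ))}

/-- The service call has an input that conforms to the input facets of its service, and `θ` gives it
a result in the output facet. -/
def CallOk (X : RMAS) {K : Type*} [Ring K] [LinearOrder K] (θ : GCall K → Obj K) (c : GCall K) :
    Prop :=
  ∃ g ∈ X.services, g.name = c.1 ∧ List.Forall₂ Facet.Mem g.input c.2 ∧ g.output.Mem (θ c)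

open Classical in
/-- The candidate database is kept if it conforms to the schema and satisfies the constraints;
otherwise the old database is kept (rollback). -/
noncomputable def commit {K : Type*} [Ring K] [LinearOrder K] (S : AgentSpec)
    (old cand : Instance K) : Instance K :=
  if Conforms S.schema cand ∧ ∀ q ∈ S.constraints, ∀ v : Var → Obj K, Typed v → q.Sat cand v
  then cand else old

open Classical in
/-- The initial database of an agent, taken from a specification with which the registry `reg`
associates it. -/
noncomputable def freshDb (X : RMAS) (K : Type*) [Ring K] (reg : Set (ℕ × ℕ)) (n : ℕ) :
    Option (Instance K) :=
  (X.allSpecs.find? fun S => decide ((n, S.name) ∈ reg)).map (AgentSpec.initial K)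

/-- The initial state. -/
noncomputable def initState (X : RMAS) (K : Type*) [Ring K] : State K :=
  freshDb X K (registryOf (X.inst.initial K))

open Classical in
/-- The state reached from `s` when sender `a` and receiver `b` update their databases to `Da` and
`Db`. A newly created agent starts with the initial database of its specification and its name. -/
noncomputable def nextState (X : RMAS) {K : Type*} [Ring K] (s : State K) (a b : ℕ)
    (Da Db : Instance K) : State K :=
  let newAS : Set (ℕ × ℕ) :=
    if a = instName then registryOf Da else if b = instName then registryOf Db else curAS s
  fun n =>
    if ∃ m, (n, m) ∈ newAS then
      if n = a then some Da
      else if n = b then some Db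
      else if ∃ m, (n, m) ∈ curAS s then s n
      else (freshDb X K newAS n).map fun D => D ∪ {(rMyName, [.agent n])}
    else none

/-- The transition relation: an active agent `a` sends an enabled message `M` to an active agent
`b`, both react by their update rules, service calls are resolved by `θ`, and each of the two agents
commits or rolls back. -/
def Step (X : RMAS) {K : Type*} [Ring K] [LinearOrder K] (s s' : State K) : Prop :=
  ∃ (a b : ℕ) (A B : AgentSpec) (Da Db : Instance K) (M : Fact K) (θ : GCall K → Obj K),
    A ∈ X.allSpecs ∧ (a, A.name) ∈ curAS s ∧ s a = some Da ∧
    B ∈ X.allSpecs ∧ (b, B.name) ∈ curAS s ∧ s b = some Db ∧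
    (M, b) ∈ enabledMsgs X A Da ∧
    (∀ c ∈ calls (pending Da (triggered A Da true M b) ∪ pending Db (triggered B Db false M a)),
      CallOk X θ c) ∧
    s' = nextState X s a b
      (commit A Da (substDb θ (pending Da (triggered A Da true M b))))
      (commit B Db (substDb θ (pending Db (triggered B Db false M a))))

/-- The states of the transition system of `X`. -/
def Reachable (X : RMAS) {K : Type*} [Ring K] [LinearOrder K] (s : State K) : Prop :=
  Relation.ReflTransGen (Step X) (initState X K) s

/-! ## Propositional temporal properties -/

/-- The propositional fragment of the verification logic: `prop p a` is the atom `p()@a`. -/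
inductive MuForm where
  | prop (p a : ℕ)
  | neg (Φ : MuForm)
  | and (Φ Ψ : MuForm)
  | pvar (Z : ℕ)
  | mu (Z : ℕ) (Φ : MuForm)
  | dia (Φ : MuForm)
  | box (Φ : MuForm)

/-- The states in which a formula holds; `μ Z. Φ` is the least (pre-)fixpoint. -/
def MuForm.sem (X : RMAS) (K : Type*) [Ring K] [LinearOrder K] :
    (ℕ → Set (State K)) → MuForm → Set (State K)
  | _, .prop p a => {s | (∃ D, s instName = some D ∧ (rAgent, [.agent a]) ∈ D) ∧
      ∃ D, s a = some D ∧ (p, []) ∈ D}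
  | V, .neg Φ => (Φ.sem X K V)ᶜ
  | V, .and Φ Ψ => Φ.sem X K V ∩ Ψ.sem X K V
  | V, .pvar Z => V Z
  | V, .mu Z Φ => ⋂₀ {S | Φ.sem X K (Function.update V Z S) ⊆ S}
  | V, .dia Φ => {s | ∃ s', Step X s s' ∧ s' ∈ Φ.sem X K V}
  | V, .box Φ => {s | ∀ s', Step X s s' → s' ∈ Φ.sem X K V}

/-- Disjunction, as an abbreviation. -/
def MuForm.or (Φ Ψ : MuForm) : MuForm := .neg (.and (.neg Φ) (.neg Ψ))

/-- The reachability property `μ Z. (p@inst ∨ ◇ Z)` of a proposition `p`. -/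
def reach (p : ℕ) : MuForm := .mu 0 (.or (.prop p instName) (.dia (.pvar 0)))

end Rmas

namespace RMAS

open Rmas

/-- The closed formula `Φ` holds in the initial state of the transition system of `X`. -/
def Models (X : RMAS) (K : Type*) [Ring K] [LinearOrder K] (Φ : MuForm) : Prop :=
  initState X K ∈ Φ.sem X K fun _ => ∅

/-- Only base facets are used. -/
def ShallowTyped (X : RMAS) : Prop := ∀ F ∈ X.facets, F.cond = .tt

/-- In every state, each agent database stores at most `b` data objects. -/
def StateBounded (X : RMAS) (K : Type*) [Ring K] [LinearOrder K] (b : ℕ) : Prop :=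
  ∀ s : State K, Reachable X s → ∀ n D, s n = some D → (adom D).encard ≤ b

/-- The institutional specification is the only one, and in every state the institutional agent is
the only active agent, registered with its own specification only. -/
def SingleAgent (X : RMAS) (K : Type*) [Ring K] [LinearOrder K] : Prop :=
  X.specs = [] ∧
  ∀ s : State K, Reachable X s →
    (∀ n, s n ≠ none ↔ n = instName) ∧ curAS s = {(instName, ispecName)}

/-- The relations of the institutional agent and the messages have arity at most one, apart from
the registry relation `hasSpec/2` that every RMAS has. -/
def UnaryOnly (X : RMAS) : Prop :=
  (∀ r ∈ X.inst.schema, r.name ≠ rHasSpec → r.types.length ≤ 1) ∧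
  ∀ m ∈ X.messages, m.types.length ≤ 1

end RMAS

namespace Rmas

/-! ## Effective coding of RMASs -/

instance : Primcodable Ty := Primcodable.ofEquiv (Fin 3)
  { toFun := fun | .agent => 0 | .spec => 1 | .num => 2
    invFun := fun | 0 => .agent | 1 => .spec | 2 => .num
    left_inv := by rintro (_ | _ | _) <;> rfl
    right_inv := by intro i; fin_cases i <;> rfl }

instance : Denumerable Const := Denumerable.ofEquiv (ℕ ⊕ ℕ ⊕ ℤ)
  { toFun := fun | .agent n => .inl n | .spec n => .inr (.inl n) | .num z => .inr (.inr z)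
    invFun := fun | .inl n => .agent n | .inr (.inl n) => .spec n | .inr (.inr z) => .num z
    left_inv := by rintro (_ | _ | _) <;> rfl
    right_inv := by rintro (_ | _ | _) <;> rfl }

instance : Denumerable Var := Denumerable.ofEquiv (ℕ ⊕ ℕ ⊕ ℕ)
  { toFun := fun | .agent n => .inl n | .spec n => .inr (.inl n) | .num z => .inr (.inr z)
    invFun := fun | .inl n => .agent n | .inr (.inl n) => .spec n | .inr (.inr z) => .num z
    left_inv := by rintro (_ | _ | _) <;> rfl
    right_inv := by rintro (_ | _ | _) <;> rfl }

instance : Denumerable Term := Denumerable.ofEquiv (Var ⊕ Const)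
  { toFun := fun | .var x => .inl x | .const c => .inr c
    invFun := fun | .inl x => .var x | .inr c => .const c
    left_inv := by rintro (_ | _) <;> rfl
    right_inv := by rintro (_ | _) <;> rfl }

instance : Denumerable AddTerm := Denumerable.ofEquiv (Term ⊕ (ℕ × List Var))
  { toFun := fun | .term t => .inl t | .call f ys => .inr (f, ys)
    invFun := fun | .inl t => .term t | .inr p => .call p.1 p.2
    left_inv := by rintro (_ | _) <;> rfl
    right_inv := by rintro (_ | _) <;> rfl }

/-- Coding of facet formulae by natural numbers. -/
def FacetForm.toNat : FacetForm → ℕ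
  | .tt => 0
  | .atom .eq t u => 5 * Encodable.encode (t, u) + 1
  | .atom .lt t u => 5 * Encodable.encode (t, u) + 2
  | .atom .succ t u => 5 * Encodable.encode (t, u) + 3
  | .neg φ => 5 * φ.toNat + 4
  | .or φ ψ => 5 * Nat.pair φ.toNat ψ.toNat + 5

/-- Decoding of facet formulae. -/
def FacetForm.ofNat : ℕ → FacetForm
  | 0 => .tt
  | n + 1 =>
    have h : n / 5 < n + 1 := Nat.lt_succ_of_le (Nat.div_le_self _ _)
    have _h1 : (n / 5).unpair.1 < n + 1 := (Nat.unpair_left_le _).trans_lt h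
    have _h2 : (n / 5).unpair.2 < n + 1 := (Nat.unpair_right_le _).trans_lt h
    let p := Denumerable.ofNat (Option Const × Option Const) (n / 5)
    match n % 5 with
    | 0 => .atom .eq p.1 p.2
    | 1 => .atom .lt p.1 p.2
    | 2 => .atom .succ p.1 p.2
    | 3 => .neg (FacetForm.ofNat (n / 5))
    | _ => .or (FacetForm.ofNat (n / 5).unpair.1) (FacetForm.ofNat (n / 5).unpair.2)

/-- Coding of queries by natural numbers. -/
def Query.toNat : Query → ℕ
  | .tt => 0
  | .rel R ts => 7 * Encodable.encode (R, ts) + 1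
  | .drel .eq t u => 7 * Encodable.encode (t, u) + 2
  | .drel .lt t u => 7 * Encodable.encode (t, u) + 3
  | .drel .succ t u => 7 * Encodable.encode (t, u) + 4
  | .neg q => 7 * q.toNat + 5
  | .and q r => 7 * Nat.pair q.toNat r.toNat + 6
  | .ex x q => 7 * Nat.pair (Encodable.encode x) q.toNat + 7

/-- Decoding of queries. -/
def Query.ofNat : ℕ → Query
  | 0 => .tt
  | n + 1 =>
    have h : n / 7 < n + 1 := Nat.lt_succ_of_le (Nat.div_le_self _ _)
    have _h1 : (n / 7).unpair.1 < n + 1 := (Nat.unpair_left_le _).trans_lt h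
    have _h2 : (n / 7).unpair.2 < n + 1 := (Nat.unpair_right_le _).trans_lt h
    let p := Denumerable.ofNat (Term × Term) (n / 7)
    let a := Denumerable.ofNat (ℕ × List Term) (n / 7)
    match n % 7 with
    | 0 => .rel a.1 a.2
    | 1 => .drel .eq p.1 p.2
    | 2 => .drel .lt p.1 p.2
    | 3 => .drel .succ p.1 p.2
    | 4 => .neg (Query.ofNat (n / 7))
    | 5 => .and (Query.ofNat (n / 7).unpair.1) (Query.ofNat (n / 7).unpair.2)
    | _ => .ex (Denumerable.ofNat Var (n / 7).unpair.1) (Query.ofNat (n / 7).unpair.2)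

theorem FacetForm.ofNat_toNat (φ : FacetForm) : FacetForm.ofNat φ.toNat = φ := by
  have e : ∀ m r, r < 5 → (5 * m + r) / 5 = m ∧ (5 * m + r) % 5 = r := by omega
  induction φ with
  | tt => rw [FacetForm.toNat, FacetForm.ofNat]
  | atom r t u =>
    cases r
    · rw [FacetForm.toNat, FacetForm.ofNat]
      obtain ⟨h, h'⟩ := e (Encodable.encode (t, u)) 0 (by omega)
      simp only [add_zero] at h h'
      simp only [h, h', Denumerable.ofNat_encode]
    · rw [FacetForm.toNat, FacetForm.ofNat]
      obtain ⟨h, h'⟩ := e (Encodable.encode (t, u)) 1 (by omega)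
      simp only [h, h', Denumerable.ofNat_encode]
    · rw [FacetForm.toNat, FacetForm.ofNat]
      obtain ⟨h, h'⟩ := e (Encodable.encode (t, u)) 2 (by omega)
      simp only [h, h', Denumerable.ofNat_encode]
  | neg φ ih =>
    rw [FacetForm.toNat, FacetForm.ofNat]
    obtain ⟨h, h'⟩ := e φ.toNat 3 (by omega)
    simp only [h, h', ih]
  | or φ ψ ih1 ih2 =>
    rw [FacetForm.toNat, FacetForm.ofNat]
    obtain ⟨h, h'⟩ := e (Nat.pair φ.toNat ψ.toNat) 4 (by omega)
    simp only [h, h', Nat.unpair_pair, ih1, ih2]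

theorem FacetForm.toNat_ofNat (n : ℕ) : (FacetForm.ofNat n).toNat = n := by
  induction n using Nat.strong_induction_on with
  | _ n ih =>
    cases n with
    | zero => rw [FacetForm.ofNat, FacetForm.toNat]
    | succ n =>
      have h : n / 5 < n + 1 := Nat.lt_succ_of_le (Nat.div_le_self _ _)
      have ih0 := ih _ h
      have ih1 := ih _ ((Nat.unpair_left_le _).trans_lt h)
      have ih2 := ih _ ((Nat.unpair_right_le _).trans_lt h)
      have hm : n % 5 < 5 := Nat.mod_lt _ (by omega)
      rw [FacetForm.ofNat]
      generalize hr : n % 5 = r at hm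
      interval_cases r <;>
        simp only [FacetForm.toNat, ih0, ih1, ih2, Prod.mk.eta, Denumerable.encode_ofNat,
          Nat.pair_unpair] <;> omega

theorem Query.ofNat_toNat (q : Query) : Query.ofNat q.toNat = q := by
  have e : ∀ m r, r < 7 → (7 * m + r) / 7 = m ∧ (7 * m + r) % 7 = r := by omega
  induction q with
  | tt => rw [Query.toNat, Query.ofNat]
  | rel R ts =>
    rw [Query.toNat, Query.ofNat]
    obtain ⟨h, h'⟩ := e (Encodable.encode (R, ts)) 0 (by omega)
    simp only [add_zero] at h h'
    simp only [h, h', Denumerable.ofNat_encode]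
  | drel r t u =>
    cases r
    · rw [Query.toNat, Query.ofNat]
      obtain ⟨h, h'⟩ := e (Encodable.encode (t, u)) 1 (by omega)
      simp only [h, h', Denumerable.ofNat_encode]
    · rw [Query.toNat, Query.ofNat]
      obtain ⟨h, h'⟩ := e (Encodable.encode (t, u)) 2 (by omega)
      simp only [h, h', Denumerable.ofNat_encode]
    · rw [Query.toNat, Query.ofNat]
      obtain ⟨h, h'⟩ := e (Encodable.encode (t, u)) 3 (by omega)
      simp only [h, h', Denumerable.ofNat_encode]
  | neg q ih =>
    rw [Query.toNat, Query.ofNat]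
    obtain ⟨h, h'⟩ := e q.toNat 4 (by omega)
    simp only [h, h', ih]
  | and q r ih1 ih2 =>
    rw [Query.toNat, Query.ofNat]
    obtain ⟨h, h'⟩ := e (Nat.pair q.toNat r.toNat) 5 (by omega)
    simp only [h, h', Nat.unpair_pair, ih1, ih2]
  | ex x q ih =>
    rw [Query.toNat, Query.ofNat]
    obtain ⟨h, h'⟩ := e (Nat.pair (Encodable.encode x) q.toNat) 6 (by omega)
    simp only [h, h', Nat.unpair_pair, ih, Denumerable.ofNat_encode]

theorem Query.toNat_ofNat (n : ℕ) : (Query.ofNat n).toNat = n := by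
  induction n using Nat.strong_induction_on with
  | _ n ih =>
    cases n with
    | zero => rw [Query.ofNat, Query.toNat]
    | succ n =>
      have h : n / 7 < n + 1 := Nat.lt_succ_of_le (Nat.div_le_self _ _)
      have ih0 := ih _ h
      have ih1 := ih _ ((Nat.unpair_left_le _).trans_lt h)
      have ih2 := ih _ ((Nat.unpair_right_le _).trans_lt h)
      have hm : n % 7 < 7 := Nat.mod_lt _ (by omega)
      rw [Query.ofNat]
      generalize hr : n % 7 = r at hm
      interval_cases r <;>
        simp only [Query.toNat, ih0, ih1, ih2, Prod.mk.eta, Denumerable.encode_ofNat,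
          Nat.pair_unpair] <;> omega

instance : Denumerable FacetForm := Denumerable.mk'
  ⟨FacetForm.toNat, FacetForm.ofNat, FacetForm.ofNat_toNat, FacetForm.toNat_ofNat⟩

instance : Denumerable Query := Denumerable.mk'
  ⟨Query.toNat, Query.ofNat, Query.ofNat_toNat, Query.toNat_ofNat⟩

instance : Primcodable Facet := Primcodable.ofEquiv (Ty × FacetForm)
  { toFun := fun x => (x.ty, x.cond)
    invFun := fun p => ⟨p.1, p.2⟩ }

instance : Primcodable RelSchema := Primcodable.ofEquiv (ℕ × List Facet)
  { toFun := fun x => (x.name, x.types)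
    invFun := fun p => ⟨p.1, p.2⟩ }

instance : Primcodable Service := Primcodable.ofEquiv (ℕ × List Facet × Facet)
  { toFun := fun x => (x.name, x.input, x.output)
    invFun := fun p => ⟨p.1, p.2.1, p.2.2⟩ }

instance : Primcodable Effect :=
  Primcodable.ofEquiv (Query × List (ℕ × List AddTerm) × List (ℕ × List Term))
  { toFun := fun x => (x.query, x.add, x.del)
    invFun := fun p => ⟨p.1, p.2.1, p.2.2⟩ }

instance : Primcodable Action := Primcodable.ofEquiv (ℕ × List (Var × Facet) × List Effect)
  { toFun := fun x => (x.name, x.params, x.effects)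
    invFun := fun p => ⟨p.1, p.2.1, p.2.2⟩ }

instance : Primcodable CommRule := Primcodable.ofEquiv (Query × ℕ × List Var × Var)
  { toFun := fun x => (x.query, x.msg, x.payload, x.target)
    invFun := fun p => ⟨p.1, p.2.1, p.2.2.1, p.2.2.2⟩ }

instance : Primcodable UpdateRule :=
  Primcodable.ofEquiv (Bool × ℕ × List Var × Var × Query × ℕ × List Term)
  { toFun := fun x => (x.onSend, x.msg, x.payload, x.peer, x.cond, x.action, x.args)
    invFun := fun p => ⟨p.1, p.2.1, p.2.2.1, p.2.2.2.1, p.2.2.2.2.1, p.2.2.2.2.2.1,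
      p.2.2.2.2.2.2⟩ }

instance : Primcodable AgentSpec :=
  Primcodable.ofEquiv (ℕ × List RelSchema × List Query × List (ℕ × List Const) × List CommRule ×
    List Action × List UpdateRule)
  { toFun := fun x => (x.name, x.schema, x.constraints, x.initDb, x.comm, x.actions, x.updates)
    invFun := fun p => ⟨p.1, p.2.1, p.2.2.1, p.2.2.2.1, p.2.2.2.2.1, p.2.2.2.2.2.1,
      p.2.2.2.2.2.2⟩ }

instance : Primcodable RMAS :=
  Primcodable.ofEquiv (List Facet × List Const × List Service × List RelSchema ×
    List AgentSpec × AgentSpec)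
  { toFun := fun x => (x.facets, x.initDom, x.services, x.messages, x.specs, x.inst)
    invFun := fun p => ⟨p.1, p.2.1, p.2.2.1, p.2.2.2.1, p.2.2.2.2.1, p.2.2.2.2.2⟩ }

/-- The problem `P`, restricted to the inputs in `C`, is decidable: some algorithm terminates with
the right answer on every input in `C` (on other inputs it may do anything). -/
def DecidableOn {α : Type*} [Primcodable α] (C : Set α) (P : α → Prop) : Prop :=
  ∃ f : α →. Bool, Partrec f ∧ ∀ x ∈ C, ∃ v ∈ f x, (v = true ↔ P x)

end Rmas

/-! # Nondeterministic register programs -/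

namespace RegisterProgram

open Rmas Relation

/-! The halting problem is reduced to reachability, by way of nondeterministic programs over
finitely many registers with contents in `K`. Guessing followed by testing replaces arithmetic: to
increment, guess a new content and test it against the old one with `succ`. In this way a bounded
number of registers simulates a counter machine. That `K` may have many elements that are not
natural numbers does no harm: loops start from `0` and advance by `succ`, so they reach only casts
of naturals, and in a strictly ordered ring these casts are injective and order preserving.

On the program side, input-output relations of programs are closed under composition, union and
iteration (`Realizable`). Hence the predicates that programs can test (`Definable`) are closed under
conjunction, disjunction, existential quantification (guess fresh registers) and loops with a
definable step. The only arithmetic still needed is the pairing function, which a loop computes by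
enumerating all pairs in the order of their codes, using only increments, comparisons and zeros
(`Definable.isPair`). Induction over `Nat.Partrec` then makes the graph of every partial recursive
function testable (`graphDefinable_of_partrec`), so that its domain is the halting set of a program.

On the system side, the institutional agent runs the program by sending messages to itself. A
register becomes a unary relation with exactly one element, a program point a proposition, an edge a
message with its own update action, and a guess a service call. Reachable states are exactly
reachable configurations (`step_iff`, `reachable_iff`), and each stores at most the `k` register
contents and the two names of the agent and its specification.

The program is fixed once and for all: it semidecides whether the code in its registers halts on
input `0`. An instance of the halting problem enters only as a constant in the initial database,
which makes the reduction primitive recursive and the bound `k + 2` the same for all instances. -/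

/-- Instructions over registers that hold elements of `K`: guess a new content, compare the contents
of two registers, test for zero. -/
inductive Instr where
  | havoc (i : ℕ)
  | test (r : DRel) (i j : ℕ)
  | isZero (i : ℕ)

/-- A transition between two program points. -/
structure Edge where
  src : ℕ
  instr : Instr
  dst : ℕ

variable {K : Type*} [Ring K] [LinearOrder K]

/-- The effect of an instruction on the contents of the registers. -/
def Instr.Sem : Instr → (ℕ → K) → (ℕ → K) → Prop
  | .havoc i, v, w => ∃ a, w = Function.update v i a
  | .test r i j, v, w => w = v ∧ r.Holds (.num (v i)) (.num (v j))
  | .isZero i, v, w => w = v ∧ v i = 0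

/-- The transition relation of a program. -/
def EStep (E : List Edge) (c d : ℕ × (ℕ → K)) : Prop :=
  ∃ e ∈ E, c.1 = e.src ∧ d.1 = e.dst ∧ e.instr.Sem c.2 d.2

theorem EStep.mono {E F : List Edge} (h : E ⊆ F) {c d : ℕ × (ℕ → K)}
    (hr : ReflTransGen (EStep E) c d) : ReflTransGen (EStep F) c d :=
  ReflTransGen.mono (r := EStep E) (fun _ _ ⟨e, he, h'⟩ => ⟨e, h he, h'⟩) _ _ hr

theorem EStep.of_mem {E : List Edge} {s t : ℕ} {ins : Instr} (h : ⟨s, ins, t⟩ ∈ E) {v w : ℕ → K}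
    (hs : ins.Sem v w) : ReflTransGen (EStep E) (s, v) (t, w) :=
  .single ⟨_, h, rfl, rfl, hs⟩

/-! ### Input-output relations of programs: composition, union, iteration -/

/-- The relation `R` between register contents is the input-output relation of programs with any
prescribed start and end points and with fresh inner points. Soundness is expressed by an annotation
`I` of the program points that is preserved by all transitions. -/
def Realizable (R : (ℕ → K) → (ℕ → K) → Prop) : Prop :=
  ∀ s t lo, s < lo → t < lo → s ≠ t → ∃ (E : List Edge) (hi : ℕ), lo ≤ hi ∧
    (∀ e ∈ E, (e.src = s ∨ lo ≤ e.src ∧ e.src < hi) ∧ (e.dst = t ∨ lo ≤ e.dst ∧ e.dst < hi)) ∧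
    (∀ v w, R v w → ReflTransGen (EStep E) (s, v) (t, w)) ∧
    ∃ I : ℕ → (ℕ → K) → (ℕ → K) → Prop, (∀ v, I s v v) ∧
      (∀ e ∈ E, ∀ v w w', I e.src v w → e.instr.Sem w w' → I e.dst v w') ∧
      ∀ v w, I t v w → R v w

theorem Realizable.instr (ins : Instr) : Realizable (K := K) ins.Sem := by
  intro s t lo hs ht hst
  refine ⟨[⟨s, ins, t⟩], lo, le_rfl, by simp, fun v w h => EStep.of_mem (by simp) h,
    fun q v w => (q = s ∧ w = v) ∨ (q = t ∧ ins.Sem v w), by simp, ?_, ?_⟩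
  · simp only [List.mem_singleton]
    rintro e rfl v w w' (⟨-, rfl⟩ | ⟨h, -⟩) h'
    · exact .inr ⟨rfl, h'⟩
    · exact absurd h hst
  · rintro v w (⟨h, -⟩ | ⟨-, h⟩)
    · exact absurd h.symm hst
    · exact h

/-- The point `lo` becomes the junction, and the inner points of the two programs are taken from
disjoint intervals. No edge of the first program leaves the junction and none of the second enters
it from its own inner points, so a run crosses it exactly once. -/
theorem Realizable.comp {R S : (ℕ → K) → (ℕ → K) → Prop} (hR : Realizable R)
    (hS : Realizable S) : Realizable (Relation.Comp R S) := by
  intro s t lo hs ht hst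
  obtain ⟨E, h1, hlo, hE, hEc, I, hI0, hI1, hI2⟩ :=
    hR s lo (lo + 1) (by omega) (by omega) (by omega)
  obtain ⟨F, h2, hlo', hF, hFc, J, hJ0, hJ1, hJ2⟩ := hS lo t h1 (by omega) (by omega) (by omega)
  -- Before the junction the invariant of the first program holds; from the junction on, an
  -- intermediate valuation `u` is remembered and the second invariant is counted from it.
  refine ⟨E ++ F, h2, by omega, ?_, ?_, fun q v w =>
    ((q = s ∨ lo + 1 ≤ q ∧ q < h1) ∧ I q v w) ∨
    ((q = lo ∨ q = t ∨ h1 ≤ q ∧ q < h2) ∧ ∃ u, R v u ∧ J q u w), ?_, ?_, ?_⟩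
  · intro e he
    rcases List.mem_append.1 he with he | he
    · have := hE e he; omega
    · have := hF e he; omega
  · rintro v w ⟨u, hu, hw⟩
    exact (EStep.mono (by simp) (hEc v u hu)).trans (EStep.mono (by simp) (hFc u w hw))
  · exact fun v => .inl ⟨.inl rfl, hI0 v⟩
  · intro e he v w w' h hs
    rcases List.mem_append.1 he with he | he
    · have hb := hE e he
      rcases h with ⟨-, h⟩ | ⟨h, -⟩
      · have h' := hI1 e he v w w' h hs
        rcases hb.2 with hd | hd
        · rw [hd] at h' ⊢
          exact .inr ⟨.inl rfl, w', hI2 _ _ h', hJ0 _⟩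
        · exact .inl ⟨.inr hd, h'⟩
      · omega
    · have hb := hF e he
      rcases h with ⟨h, -⟩ | ⟨-, u, hu, h⟩
      · omega
      · exact .inr ⟨.inr hb.2, u, hu, hJ1 e he u w w' h hs⟩
  · rintro v w (⟨h, -⟩ | ⟨-, u, hu, h⟩)
    · omega
    · exact ⟨u, hu, hJ2 _ _ h⟩

/-- The two programs share only their end points. Since by `Realizable` no edge enters the start or
leaves the end, a run can never switch from one program to the other. -/
theorem Realizable.union {R S : (ℕ → K) → (ℕ → K) → Prop} (hR : Realizable R)
    (hS : Realizable S) : Realizable (fun v w => R v w ∨ S v w) := by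
  intro s t lo hs ht hst
  obtain ⟨E, h1, hlo, hE, hEc, I, hI0, hI1, hI2⟩ := hR s t lo hs ht hst
  obtain ⟨F, h2, hlo', hF, hFc, J, hJ0, hJ1, hJ2⟩ := hS s t h1 (by omega) (by omega) hst
  refine ⟨E ++ F, h2, by omega, ?_, ?_, fun q v w => (q = s ∧ w = v) ∨
    ((lo ≤ q ∧ q < h1) ∧ I q v w) ∨ ((h1 ≤ q ∧ q < h2) ∧ J q v w) ∨ (q = t ∧ (R v w ∨ S v w)),
    by simp, ?_, ?_⟩
  · intro e he
    rcases List.mem_append.1 he with he | he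
    · have := hE e he; omega
    · have := hF e he; omega
  · rintro v w (h | h)
    · exact EStep.mono (by simp) (hEc v w h)
    · exact EStep.mono (by simp) (hFc v w h)
  · intro e he v w w' h hs
    rcases List.mem_append.1 he with he | he
    · have hb := hE e he
      have h' : I e.src v w := by
        rcases h with ⟨h, rfl⟩ | ⟨-, h⟩ | ⟨h, -⟩ | ⟨h, -⟩
        · rw [h]; exact hI0 _
        · exact h
        all_goals omega
      have h' := hI1 e he v w w' h' hs
      rcases hb.2 with hd | hd
      · rw [hd] at h' ⊢
        exact .inr (.inr (.inr ⟨rfl, .inl (hI2 _ _ h')⟩))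
      · exact .inr (.inl ⟨hd, h'⟩)
    · have hb := hF e he
      have h' : J e.src v w := by
        rcases h with ⟨h, rfl⟩ | ⟨h, -⟩ | ⟨-, h⟩ | ⟨h, -⟩
        · rw [h]; exact hJ0 _
        · omega
        · exact h
        · omega
      have h' := hJ1 e he v w w' h' hs
      rcases hb.2 with hd | hd
      · rw [hd] at h' ⊢
        exact .inr (.inr (.inr ⟨rfl, .inr (hJ2 _ _ h')⟩))
      · exact .inr (.inr (.inl ⟨hd, h'⟩))
  · rintro v w (⟨h, -⟩ | ⟨h, -⟩ | ⟨h, -⟩ | ⟨-, h⟩)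
    · exact absurd h.symm hst
    · omega
    · omega
    · exact h

/-- The body runs between two new points `lo` and `lo + 1`. Edges without effect lead into `lo`,
back from `lo + 1` to `lo`, and from `lo` to the exit. The new points are needed because
`Realizable` allows no edge back into the start. -/
theorem Realizable.star {R : (ℕ → K) → (ℕ → K) → Prop} (hR : Realizable R) :
    Realizable (ReflTransGen R) := by
  intro s t lo hs ht hst
  obtain ⟨E, hi, hlo, hE, hEc, I, hI0, hI1, hI2⟩ :=
    hR lo (lo + 1) (lo + 2) (by omega) (by omega) (by omega)
  -- There is no instruction without effect; comparing register `0` with itself serves as one.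
  let skip : Instr := .test .eq 0 0
  have hskip : ∀ v : ℕ → K, skip.Sem v v := fun v => ⟨rfl, rfl⟩
  have hskip' : ∀ v w : ℕ → K, skip.Sem v w → w = v := fun v w h => h.1
  refine ⟨⟨s, skip, lo⟩ :: ⟨lo + 1, skip, lo⟩ :: ⟨lo, skip, t⟩ :: E, hi, by omega, ?_, ?_,
    fun q v w => (q = s ∧ w = v) ∨ ((lo + 2 ≤ q ∧ q < hi) ∧ ∃ u, ReflTransGen R v u ∧ I q u w) ∨
      ((q = lo ∨ q = lo + 1 ∨ q = t) ∧ ReflTransGen R v w), by simp, ?_, ?_⟩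
  · intro e he
    simp only [List.mem_cons] at he
    rcases he with rfl | rfl | rfl | he
    · simp; omega
    · simp; omega
    · simp; omega
    · have := hE e he; omega
  · intro v w h
    refine (EStep.of_mem (t := lo) (List.mem_cons_self ..) (hskip v)).trans
      (ReflTransGen.trans (b := (lo, w)) ?_ (EStep.of_mem (ins := skip) (by simp) (hskip w)))
    induction h with
    | refl => exact .refl
    | @tail b c _ hbc ih =>
      exact ih.trans ((EStep.mono (fun _ h => by simp [h]) (hEc _ _ hbc)).trans
        (EStep.of_mem (ins := skip) (by simp) (hskip c)))
  · intro e he v w w' h hs'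
    simp only [List.mem_cons] at he
    rcases he with rfl | rfl | rfl | he
    · cases hskip' _ _ hs'
      rcases h with ⟨-, rfl⟩ | ⟨h, -⟩ | ⟨h, -⟩
      · exact .inr (.inr ⟨.inl rfl, .refl⟩)
      all_goals dsimp only at h; omega
    · cases hskip' _ _ hs'
      rcases h with ⟨h, -⟩ | ⟨h, -⟩ | ⟨-, h⟩
      · dsimp only at h; omega
      · dsimp only at h; omega
      · exact .inr (.inr ⟨.inl rfl, h⟩)
    · cases hskip' _ _ hs'
      rcases h with ⟨h, -⟩ | ⟨h, -⟩ | ⟨-, h⟩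
      · dsimp only at h; omega
      · dsimp only at h; omega
      · exact .inr (.inr ⟨.inr (.inr rfl), h⟩)
    · have hb := hE e he
      have h' : ∃ u, ReflTransGen R v u ∧ I e.src u w := by
        rcases h with ⟨h, -⟩ | ⟨-, h⟩ | ⟨h, h'⟩
        · omega
        · exact h
        · have : e.src = lo := by omega
          exact ⟨w, h', this ▸ hI0 w⟩
      obtain ⟨u, hu, h'⟩ := h'
      have h' := hI1 e he u w w' h' hs'
      rcases hb.2 with hd | hd
      · rw [hd] at h' ⊢
        exact .inr (.inr ⟨.inr (.inl rfl), hu.tail (hI2 _ _ h')⟩)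
      · exact .inr (.inl ⟨hd, u, hu, h'⟩)
  · rintro v w (⟨h, -⟩ | ⟨h, -⟩ | ⟨-, h⟩)
    · exact absurd h.symm hst
    · omega
    · exact h

/-- A realizable relation is the reachability relation between two points of a finite program. -/
theorem Realizable.exists_program {R : (ℕ → K) → (ℕ → K) → Prop} (hR : Realizable R) :
    ∃ E : List Edge, ∀ v w, ReflTransGen (EStep E) (1, v) (0, w) ↔ R v w := by
  obtain ⟨E, -, -, -, hEc, I, hI0, hI1, hI2⟩ := hR 1 0 2 (by omega) (by omega) (by omega)
  refine ⟨E, fun v w => ⟨fun h => hI2 v w ?_, hEc v w⟩⟩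
  have : ∀ c, ReflTransGen (EStep E) (1, v) c → I c.1 v c.2 := by
    intro c hc
    induction hc with
    | refl => exact hI0 v
    | tail _ hbc ih =>
      obtain ⟨e, he, h1, h2, h3⟩ := hbc
      rw [h2]
      exact hI1 e he v _ _ (h1 ▸ ih) h3
  exact this _ h

end RegisterProgram

/-! # Predicates that are tested by register programs -/

namespace RegisterProgram

open Rmas Relation

section

variable {K : Type*}

/-- The registers below `n` have the same contents. -/
def Agree (n : ℕ) (v w : ℕ → K) : Prop := ∀ i < n, w i = v i

theorem Agree.refl (n : ℕ) (v : ℕ → K) : Agree n v v := fun _ _ => rfl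

theorem Agree.symm {n : ℕ} {v w : ℕ → K} (h : Agree n v w) : Agree n w v :=
  fun i hi => (h i hi).symm

theorem Agree.trans {n : ℕ} {u v w : ℕ → K} (h : Agree n u v) (h' : Agree n v w) : Agree n u w :=
  fun i hi => (h' i hi).trans (h i hi)

theorem Agree.mono {m n : ℕ} (hmn : m ≤ n) {v w : ℕ → K} (h : Agree n v w) : Agree m v w :=
  fun i hi => h i (hi.trans_le hmn)

/-- The contents of `r` registers from `n` on are overwritten by those of the next `r` registers, as
they are in some extension of the registers below `n + r` that satisfies `φ`. -/
def LoopStep (n r : ℕ) (φ : (ℕ → K) → Prop) (w w' : ℕ → K) : Prop :=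
  Agree n w w' ∧ ∃ u, Agree (n + r) w u ∧ φ u ∧ ∀ i < r, w' (n + i) = u (n + r + i)

theorem LoopStep.agree {n r : ℕ} {φ : (ℕ → K) → Prop} {w w' : ℕ → K}
    (h : ReflTransGen (LoopStep n r φ) w w') : Agree n w w' := by
  induction h with
  | refl => exact .refl _ _
  | tail _ h ih => exact ih.trans h.1

/-- The registers of `v` below `n`, followed by the contents listed in `l`. -/
def extend [Zero K] (n : ℕ) (v : ℕ → K) (l : List K) (i : ℕ) : K :=
  if i < n then v i else l.getD (i - n) 0

theorem extend_of_lt [Zero K] {n i : ℕ} (v : ℕ → K) (l : List K) (h : i < n) :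
    extend n v l i = v i := if_pos h

@[simp] theorem extend_self [Zero K] (n : ℕ) (v : ℕ → K) (l : List K) :
    extend n v l n = l.getD 0 0 := by simp [extend]

@[simp] theorem extend_add [Zero K] (n i : ℕ) (v : ℕ → K) (l : List K) :
    extend n v l (n + i) = l.getD i 0 := by simp [extend]

theorem agree_extend [Zero K] (n : ℕ) (v : ℕ → K) (l : List K) : Agree n v (extend n v l) :=
  fun _ hi => extend_of_lt v l hi

end

variable {K : Type*} [Ring K] [LinearOrder K]

/-! ### Guessing and copying blocks of registers -/

theorem realizable_havocs (n r : ℕ) :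
    Realizable (K := K) (fun v w => ∀ i, ¬ (n ≤ i ∧ i < n + r) → w i = v i) := by
  induction r with
  | zero =>
    convert Realizable.instr (K := K) (.test .eq 0 0) using 3 with v w
    simp [Instr.Sem, DRel.Holds, funext_iff]
  | succ r ih =>
    convert ih.comp (Realizable.instr (K := K) (.havoc (n + r))) using 3 with v w
    constructor
    · intro h
      -- The intermediate valuation already has the final contents, except in the last register,
      -- which is guessed next.
      refine ⟨fun i => if i = n + r then v i else w i, fun i hi => ?_, w (n + r), ?_⟩
      · dsimp only
        split_ifs with h'
        · rfl
        · exact h i (by omega)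
      · ext i
        by_cases hi : i = n + r <;> simp [hi]
    · rintro ⟨u, hu, a, rfl⟩ i hi
      rw [Function.update_of_ne (by omega)]
      exact hu i (by omega)

/-- A copy is a guess followed by an equality test. Registers are copied upwards, so no source is
overwritten before it is read; `k ≤ r` ensures `r > 0` whenever something is copied, so that source
and target differ. -/
theorem realizable_moves (n r k : ℕ) (hk : k ≤ r) : Realizable (K := K)
    (fun v w => w = fun i => if n ≤ i ∧ i < n + k then v (i + r) else v i) := by
  induction k with
  | zero =>
    convert Realizable.instr (K := K) (.test .eq 0 0) using 3 with v w
    have : ∀ i, ¬ (n ≤ i ∧ i < n + 0) := by omega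
    simp only [this, if_false]
    simp [Instr.Sem, DRel.Holds]
  | succ k ih =>
    convert ((ih (by omega)).comp (Realizable.instr (K := K) (.havoc (n + k)))).comp
      (Realizable.instr (K := K) (.test .eq (n + k) (n + k + r))) using 3 with v w
    have key : ∀ a : K, a = v (n + k + r) →
        Function.update (fun i => if n ≤ i ∧ i < n + k then v (i + r) else v i) (n + k) a =
          fun i => if n ≤ i ∧ i < n + (k + 1) then v (i + r) else v i := by
      rintro a rfl
      ext i
      rw [Function.update_apply]
      split_ifs with h1 h2 h2
      · rw [h1]
      · omega
      · rfl
      · omega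
      · omega
      · rfl
    have h1 : ¬ (n ≤ n + k + r ∧ n + k + r < n + k) := by omega
    have h2 : n + k + r ≠ n + k := by omega
    constructor
    · rintro rfl
      refine ⟨_, ⟨_, rfl, v (n + k + r), rfl⟩, ?_, ?_⟩
      · rw [key _ rfl]
      · show Obj.num _ = Obj.num _
        rw [Function.update_self, Function.update_of_ne h2, if_neg h1]
    · rintro ⟨_, ⟨_, rfl, a, rfl⟩, rfl, h⟩
      have h : Obj.num _ = Obj.num _ := h
      rw [Function.update_self, Function.update_of_ne h2, if_neg h1] at h
      rw [key a (Obj.num.inj h)]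

/-! ### Testable predicates and their closure properties -/

/-- The predicate `φ` of the registers below `n` is tested by a program that preserves them. -/
structure Definable (n : ℕ) (φ : (ℕ → K) → Prop) : Prop where
  congr : ∀ v w, Agree n v w → φ v → φ w
  test : ∃ R : (ℕ → K) → (ℕ → K) → Prop, Realizable R ∧
    (∀ v w, R v w → φ v ∧ Agree n v w) ∧ ∀ v, φ v → ∃ w, R v w

namespace Definable

variable {n m r : ℕ} {φ ψ χ : (ℕ → K) → Prop}

theorem of_iff (h : Definable n φ) (H : ∀ v, ψ v ↔ φ v) : Definable n ψ := by
  rwa [show ψ = φ from funext fun v => propext (H v)]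

theorem compare (d : DRel) {i j : ℕ} (hi : i < n) (hj : j < n) :
    Definable (K := K) n (fun v => d.Holds (.num (v i)) (.num (v j))) where
  congr v w h h' := by rw [h i hi, h j hj]; exact h'
  test := ⟨_, .instr (.test d i j), fun v w h => ⟨h.2, h.1 ▸ .refl _ _⟩, fun v h => ⟨v, rfl, h⟩⟩

theorem eq {i j : ℕ} (hi : i < n) (hj : j < n) : Definable (K := K) n (fun v => v i = v j) :=
  (compare .eq hi hj).of_iff fun _ => by simp [DRel.Holds]

theorem lt {i j : ℕ} (hi : i < n) (hj : j < n) : Definable (K := K) n (fun v => v i < v j) :=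
  (compare .lt hi hj).of_iff fun _ => by simp [DRel.Holds]

theorem succ {i j : ℕ} (hi : i < n) (hj : j < n) :
    Definable (K := K) n (fun v => v i = v j + 1) :=
  (compare .succ hi hj).of_iff fun _ => by simp [DRel.Holds]

theorem zero {i : ℕ} (hi : i < n) : Definable (K := K) n (fun v => v i = 0) where
  congr v w h h' := by rw [h i hi]; exact h'
  test := ⟨_, .instr (.isZero i), fun v w h => ⟨h.2, h.1 ▸ .refl _ _⟩, fun v h => ⟨v, rfl, h⟩⟩

/-- The tests run one after the other. The first may spoil registers from `n` on, but `congr` says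
that the second predicate does not depend on them. -/
theorem and (hφ : Definable n φ) (hψ : Definable n ψ) : Definable n (fun v => φ v ∧ ψ v) where
  congr v w h h' := ⟨hφ.congr v w h h'.1, hψ.congr v w h h'.2⟩
  test := by
    obtain ⟨R, hR, hR1, hR2⟩ := hφ.test
    obtain ⟨S, hS, hS1, hS2⟩ := hψ.test
    refine ⟨_, hR.comp hS, ?_, ?_⟩
    · rintro v w ⟨u, hu, hw⟩
      obtain ⟨h1, h2⟩ := hR1 _ _ hu
      obtain ⟨h3, h4⟩ := hS1 _ _ hw
      exact ⟨⟨h1, hψ.congr _ _ h2.symm h3⟩, h2.trans h4⟩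
    · rintro v ⟨h1, h2⟩
      obtain ⟨u, hu⟩ := hR2 v h1
      obtain ⟨w, hw⟩ := hS2 u (hψ.congr _ _ (hR1 _ _ hu).2 h2)
      exact ⟨w, u, hu, hw⟩

theorem or (hφ : Definable n φ) (hψ : Definable n ψ) : Definable n (fun v => φ v ∨ ψ v) where
  congr v w h h' := h'.imp (hφ.congr v w h) (hψ.congr v w h)
  test := by
    obtain ⟨R, hR, hR1, hR2⟩ := hφ.test
    obtain ⟨S, hS, hS1, hS2⟩ := hψ.test
    refine ⟨_, hR.union hS, ?_, ?_⟩
    · rintro v w (h | h)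
      · exact (hR1 _ _ h).imp .inl id
      · exact (hS1 _ _ h).imp .inr id
    · rintro v (h | h)
      · exact (hR2 v h).imp fun _ => .inl
      · exact (hS2 v h).imp fun _ => .inr

/-- The quantifier is a guess of the `r` registers from `n` on, followed by the test for `φ`. -/
theorem ex (hφ : Definable (n + r) φ) : Definable n (fun v => ∃ w, Agree n v w ∧ φ w) where
  congr v w h h' := h'.imp fun u hu => ⟨h.symm.trans hu.1, hu.2⟩
  test := by
    obtain ⟨R, hR, hR1, hR2⟩ := hφ.test
    refine ⟨_, (realizable_havocs n r).comp hR, ?_, ?_⟩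
    · rintro v w ⟨u, hu, hw⟩
      obtain ⟨h1, h2⟩ := hR1 _ _ hw
      have h : Agree n v u := fun i hi => hu i (by omega)
      exact ⟨⟨u, h, h1⟩, h.trans (h2.mono (by omega))⟩
    · rintro v ⟨w, hw, h⟩
      -- The witness may differ from `v` in every register from `n` on, while only `r` of them are
      -- guessed. As `φ` sees only the registers below `n + r`, the others are reset to those of
      -- `v`.
      obtain ⟨u, hu⟩ := hR2 (fun i => if i < n + r then w i else v i)
        (hφ.congr w _ (fun i hi => if_pos hi) h)
      refine ⟨u, _, fun i hi => ?_, hu⟩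
      split_ifs with h'
      · exact hw i (by omega)
      · rfl

/-- The program guesses the `r` loop registers, tests `ψ`, iterates a body, and finally tests `χ`.
Every round of the body guesses the next values in a second block of `r` registers, tests `φ` on
both blocks, and moves the second block onto the first. -/
theorem loop (hψ : Definable (n + r) ψ) (hφ : Definable (n + r + r) φ)
    (hχ : Definable (n + r) χ) : Definable n (fun v => ∃ w w', Agree n v w ∧ ψ w ∧
      ReflTransGen (LoopStep n r φ) w w' ∧ χ w') where
  congr := by
    rintro v u h ⟨w, w', h1, h2⟩
    exact ⟨w, w', h.symm.trans h1, h2⟩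
  test := by
    obtain ⟨R, hR, hR1, hR2⟩ := hφ.test
    obtain ⟨S, hS, hS1, hS2⟩ := hψ.test
    obtain ⟨T, hT, hT1, hT2⟩ := hχ.test
    let body := Relation.Comp (Relation.Comp
      (fun v w : ℕ → K => ∀ i, ¬ (n + r ≤ i ∧ i < n + r + r) → w i = v i) R)
      (fun v w => w = fun i => if n ≤ i ∧ i < n + r then v (i + r) else v i)
    have hbody : Realizable body :=
      ((realizable_havocs (n + r) r).comp hR).comp (realizable_moves n r r le_rfl)
    have sound : ∀ w w', body w w' → LoopStep n r φ w w' := by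
      rintro w _ ⟨u, ⟨u', h1, h2⟩, rfl⟩
      obtain ⟨h3, h4⟩ := hR1 _ _ h2
      refine ⟨fun i hi => ?_, u', fun i hi => h1 i (by omega), h3, fun i hi => ?_⟩
      · beta_reduce
        rw [if_neg (by omega), h4 i (by omega), h1 i (by omega)]
      · beta_reduce
        rw [if_pos (by omega), h4 _ (by omega)]
        congr 1; omega
    -- The tests may alter the registers from `n + r` on, so the program follows a given sequence of
    -- loop steps only up to agreement below `n + r`.
    have complete : ∀ w w' u, LoopStep n r φ w w' → Agree (n + r) w u →
        ∃ u', body u u' ∧ Agree (n + r) w' u' := by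
      rintro w w' u ⟨h1, x, h2, h3, h4⟩ hu
      obtain ⟨y, hy⟩ := hR2 (fun i => if i < n + r + r then x i else u i)
        (hφ.congr x _ (fun i hi => if_pos hi) h3)
      refine ⟨_, ⟨y, ⟨_, fun i hi => ?_, hy⟩, rfl⟩, fun i hi => ?_⟩
      · split_ifs with h'
        · rw [h2 i (by omega), hu i (by omega)]
        · rfl
      · have hy' : ∀ j < n + r + r, y j = x j :=
          fun j hj => ((hR1 _ _ hy).2 j hj).trans (if_pos hj)
        split_ifs with h'
        · rw [hy' _ (by omega)]
          obtain ⟨j, rfl⟩ := Nat.exists_eq_add_of_le h'.1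
          rw [h4 j (by omega)]
          congr 1; omega
        · rw [hy' _ (by omega), h2 i hi, h1 i (by omega)]
    have complete' : ∀ w w', ReflTransGen (LoopStep n r φ) w w' → ∀ u, Agree (n + r) w u →
        ∃ u', ReflTransGen body u u' ∧ Agree (n + r) w' u' := by
      intro w w' h u hu
      induction h with
      | refl => exact ⟨u, .refl, hu⟩
      | tail _ h ih =>
        obtain ⟨u', h1, h2⟩ := ih
        obtain ⟨u'', h3, h4⟩ := complete _ _ u' h h2
        exact ⟨u'', h1.tail h3, h4⟩
    refine ⟨_, (((realizable_havocs n r).comp hS).comp hbody.star).comp hT, ?_, ?_⟩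
    · rintro v w ⟨u, ⟨x, ⟨y, h1, h2⟩, h3⟩, h4⟩
      obtain ⟨h5, h6⟩ := hS1 _ _ h2
      obtain ⟨h7, h8⟩ := hT1 _ _ h4
      have h1' : Agree n v y := fun i hi => h1 i (by omega)
      have h3' := ReflTransGen.mono (r := body) sound _ _ h3
      have h6' := h1'.trans (h6.mono (by omega))
      exact ⟨⟨x, u, h6', hψ.congr _ _ h6 h5, h3', h7⟩,
        (h6'.trans (LoopStep.agree h3')).trans (h8.mono (by omega))⟩
    · rintro v ⟨w, w', h1, h2, h3, h4⟩
      obtain ⟨x, hx⟩ := hS2 (fun i => if i < n + r then w i else v i)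
        (hψ.congr w _ (fun i hi => if_pos hi) h2)
      have h5 : Agree (n + r) w x := fun i hi => by
        rw [(hS1 _ _ hx).2 i hi]; exact if_pos hi
      obtain ⟨u, hu, hu'⟩ := complete' _ _ h3 x h5
      obtain ⟨y, hy⟩ := hT2 u (hχ.congr _ _ hu' h4)
      refine ⟨y, u, ⟨x, ⟨_, fun i hi => ?_, hx⟩, hu⟩, hy⟩
      split_ifs with h'
      · exact h1 i (by omega)
      · rfl

end Definable

end RegisterProgram

/-! # Register programs for partial recursive functions -/

namespace RegisterProgram

open Rmas Relation

variable {K : Type*} [Ring K]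

/-- The graph of the pairing function. -/
def IsPair (x y z : K) : Prop := ∃ a b : ℕ, x = a ∧ y = b ∧ z = (Nat.pair a b : ℕ)

/-- The graph of a partial function. -/
def Graph (f : ℕ →. ℕ) (x y : K) : Prop := ∃ a b : ℕ, x = a ∧ y = b ∧ b ∈ f a

theorem isPair_cast (a b : ℕ) : IsPair (K := K) a b (Nat.pair a b : ℕ) := ⟨a, b, rfl, rfl, rfl⟩

theorem graph_cast {f : ℕ →. ℕ} {a b : ℕ} (h : b ∈ f a) : Graph (K := K) f a b :=
  ⟨a, b, rfl, rfl, h⟩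

variable [LinearOrder K]

/-! ### Enumeration of pairs in the order of their codes -/

/-- The step from `(c, a, b)` with `c = Nat.pair a b` to the next triple of this kind. -/
def ShellStep (c a b c' a' b' : K) : Prop :=
  c' = c + 1 ∧ ((a < b ∧ ((a' = a + 1 ∧ a' < b ∧ b' = b) ∨ (b = a + 1 ∧ a' = b ∧ b' = 0))) ∨
    (b < a ∧ a' = a ∧ b' = b + 1) ∨ (b = a ∧ a' = 0 ∧ b' = b + 1))

/-- `Nat.pair` enumerates the shells of constant maximum `s` in turn: first `(0, s), …, (s - 1, s)`,
then `(s, 0), …, (s, s)`, after which the next shell starts at `(0, s + 1)`. The disjuncts of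
`ShellStep` are the moves along a shell, its corner, and the passage to the next shell. -/
theorem ShellStep.exists_pair [IsStrictOrderedRing K] {a b : ℕ} {c' a' b' : K}
    (h : ShellStep ((Nat.pair a b : ℕ) : K) a b c' a' b') :
    ∃ x y : ℕ, a' = x ∧ b' = y ∧ c' = (Nat.pair x y : ℕ) := by
  obtain ⟨rfl, ⟨h1, (⟨rfl, h2, rfl⟩ | ⟨h2, rfl, rfl⟩)⟩ | ⟨h1, rfl, rfl⟩ | ⟨h1, rfl, rfl⟩⟩ := h
  · refine ⟨a + 1, b, by simp, rfl, ?_⟩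
    rw [Nat.cast_lt] at h1
    have h2 : a + 1 < b := by exact_mod_cast h2
    rw [Nat.pair, Nat.pair, if_pos h1, if_pos h2]
    push_cast; abel
  · have h2 : b = a + 1 := by exact_mod_cast h2
    subst h2
    refine ⟨a + 1, 0, rfl, by simp, ?_⟩
    rw [Nat.pair, Nat.pair, if_pos (by omega), if_neg (by omega)]
    push_cast; abel
  · rw [Nat.cast_lt] at h1
    refine ⟨a, b + 1, rfl, by simp, ?_⟩
    rw [Nat.pair, Nat.pair, if_neg (by omega), if_neg (by omega)]
    push_cast; abel
  · have h1 : b = a := by exact_mod_cast h1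
    subst h1
    refine ⟨0, b + 1, by simp, by simp, ?_⟩
    rw [Nat.pair, Nat.pair, if_neg (by omega), if_pos (by omega)]
    exact_mod_cast (by ring : b * b + b + b + 1 = (b + 1) * (b + 1) + 0)

theorem exists_shellStep [IsStrictOrderedRing K] (c : ℕ) :
    ShellStep (c : K) c.unpair.1 c.unpair.2 (c + 1 : ℕ) (c + 1).unpair.1 (c + 1).unpair.2 := by
  obtain ⟨⟨a, b⟩, rfl⟩ : ∃ x : ℕ × ℕ, Nat.pair x.1 x.2 = c := ⟨c.unpair, Nat.pair_unpair c⟩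
  -- It is enough to name the next pair by its code; `Nat.unpair` then recovers its components.
  have key : ∀ x y : ℕ, Nat.pair a b + 1 = Nat.pair x y →
      ShellStep ((Nat.pair a b : ℕ) : K) a b (Nat.pair x y : ℕ) x y →
      ShellStep ((Nat.pair a b : ℕ) : K) (Nat.pair a b).unpair.1 (Nat.pair a b).unpair.2
        (Nat.pair a b + 1 : ℕ) (Nat.pair a b + 1).unpair.1 (Nat.pair a b + 1).unpair.2 := by
    intro x y h h'
    rwa [h, Nat.unpair_pair, Nat.unpair_pair]
  dsimp only
  rcases lt_trichotomy a b with h | rfl | h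
  · rcases (show a + 1 ≤ b from h).lt_or_eq with h' | h'
    · have e : Nat.pair a b + 1 = Nat.pair (a + 1) b := by
        rw [Nat.pair, Nat.pair, if_pos h, if_pos h']; ring
      refine key _ _ e ⟨by rw [← e]; push_cast; rfl, .inl ⟨by exact_mod_cast h, .inl ?_⟩⟩
      exact ⟨by push_cast; rfl, by exact_mod_cast h', rfl⟩
    · subst h'
      have e : Nat.pair a (a + 1) + 1 = Nat.pair (a + 1) 0 := by
        rw [Nat.pair, Nat.pair, if_pos h, if_neg (by omega)]; ring
      refine key _ _ e ⟨by rw [← e]; push_cast; rfl, .inl ⟨by exact_mod_cast h, .inr ?_⟩⟩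
      exact ⟨by push_cast; rfl, rfl, by simp⟩
  · have e : Nat.pair a a + 1 = Nat.pair 0 (a + 1) := by
      rw [Nat.pair, Nat.pair, if_neg (by omega), if_pos (by omega)]; ring
    exact key _ _ e ⟨by rw [← e]; push_cast; rfl, .inr (.inr ⟨rfl, by simp, by push_cast; rfl⟩)⟩
  · have e : Nat.pair a b + 1 = Nat.pair a (b + 1) := by
      rw [Nat.pair, Nat.pair, if_neg (by omega), if_neg (by omega)]; ring
    exact key _ _ e ⟨by rw [← e]; push_cast; rfl,
      .inr (.inl ⟨by exact_mod_cast h, rfl, by push_cast; rfl⟩)⟩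


variable [IsStrictOrderedRing K]

theorem IsPair.eq {a b : ℕ} {z : K} (h : IsPair (a : K) b z) : z = (Nat.pair a b : ℕ) := by
  obtain ⟨x, y, h1, h2, h3⟩ := h
  rw [Nat.cast_inj] at h1 h2
  rw [h3, h1, h2]

theorem Graph.exists_mem {f : ℕ →. ℕ} {a : ℕ} {y : K} (h : Graph f (a : K) y) :
    ∃ b ∈ f a, y = (b : K) := by
  obtain ⟨x, b, h1, h2, h3⟩ := h
  rw [Nat.cast_inj] at h1
  exact ⟨b, h1 ▸ h3, h2⟩

/-- A loop over `(c, a, b)` runs through the enumeration from `(0, 0, 0)` until it meets the three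
given contents. Since it starts at zero, success also certifies that these contents are casts of
naturals. -/
theorem Definable.isPair {n i j k : ℕ} (hi : i < n) (hj : j < n) (hk : k < n) :
    Definable (K := K) n (fun v => IsPair (v i) (v j) (v k)) := by
  have step : Definable (K := K) (n + 3 + 3) (fun v => ShellStep (v n) (v (n + 1)) (v (n + 2))
      (v (n + 3)) (v (n + 4)) (v (n + 5))) := by
    refine .and (.succ ?_ ?_) (.or (.and (.lt ?_ ?_) (.or (.and (.succ ?_ ?_) (.and (.lt ?_ ?_)
      (.eq ?_ ?_))) (.and (.succ ?_ ?_) (.and (.eq ?_ ?_) (.zero ?_)))))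
      (.or (.and (.lt ?_ ?_) (.and (.eq ?_ ?_) (.succ ?_ ?_)))
        (.and (.eq ?_ ?_) (.and (.zero ?_) (.succ ?_ ?_))))) <;> omega
  refine (Definable.loop (n := n) (r := 3)
    (ψ := fun v => v n = 0 ∧ v (n + 1) = 0 ∧ v (n + 2) = 0)
    (χ := fun v => v n = v k ∧ v (n + 1) = v i ∧ v (n + 2) = v j)
    (.and (.zero (by omega)) (.and (.zero (by omega)) (.zero (by omega)))) step
    (.and (.eq (by omega) (by omega)) (.and (.eq (by omega) (by omega))
      (.eq (by omega) (by omega))))).of_iff fun v => ⟨?_, ?_⟩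
  · rintro ⟨a, b, h1, h2, h3⟩
    have key : ∀ c : ℕ, ReflTransGen (LoopStep n 3 fun v : ℕ → K => ShellStep (v n) (v (n + 1))
        (v (n + 2)) (v (n + 3)) (v (n + 4)) (v (n + 5))) (extend n v [0, 0, 0])
        (extend n v [(c : K), (c.unpair.1 : K), (c.unpair.2 : K)]) := by
      intro c
      induction c with
      | zero => simp only [Nat.unpair_zero, Prod.fst_zero, Prod.snd_zero, Nat.cast_zero]; exact .refl
      | succ c ih =>
        refine ih.tail ⟨fun x hx => by simp only [extend_of_lt _ _ hx], extend n v
          [(c : K), (c.unpair.1 : K), (c.unpair.2 : K), ((c + 1 : ℕ) : K),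
            ((c + 1).unpair.1 : K), ((c + 1).unpair.2 : K)], ?_, ?_, ?_⟩
        · intro x hx
          by_cases hx' : x < n
          · simp only [extend_of_lt _ _ hx']
          · obtain ⟨y, rfl⟩ := Nat.exists_eq_add_of_le (not_lt.1 hx')
            have : y < 3 := by omega
            interval_cases y <;> simp
        · simpa using exists_shellStep c
        · intro x hx
          rw [add_assoc]
          interval_cases x <;> simp
    refine ⟨_, _, agree_extend n v _, ?_, key (Nat.pair a b), ?_⟩
    · simp
    · simp [extend_of_lt, hi, hj, hk, h1, h2, h3]
  · rintro ⟨w, w', h1, ⟨h2, h3, h4⟩, h5, h6, h7, h8⟩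
    have key : IsPair (w' (n + 1)) (w' (n + 2)) (w' n) := by
      clear h6 h7 h8
      induction h5 with
      | refl => exact ⟨0, 0, by simp [h3], by simp [h4], by
          rw [h2, show Nat.pair 0 0 = 0 from rfl, Nat.cast_zero]⟩
      | tail _ h ih =>
        obtain ⟨-, u, hu, hs, hu'⟩ := h
        obtain ⟨a, b, e1, e2, e3⟩ := ih
        rw [hu n (by omega), hu (n + 1) (by omega), hu (n + 2) (by omega), e1, e2, e3] at hs
        have := hs.exists_pair
        rw [hu' 1 (by omega), hu' 2 (by omega)]
        exact (hu' 0 (by omega)).symm ▸ this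
    have ha := h1.trans (LoopStep.agree h5)
    rwa [h6, h7, h8, ha _ hi, ha _ hj, ha _ hk] at key

/-- Every natural number is the code of a pair, and `IsPair` admits no other elements of `K`. -/
theorem Definable.isNat {n i : ℕ} (hi : i < n) :
    Definable (K := K) n (fun v => ∃ a : ℕ, v i = a) := by
  refine (Definable.ex (r := 2) (Definable.isPair (i := n) (j := n + 1) (k := i) (by omega)
    (by omega) (by omega))).of_iff fun v => ⟨?_, ?_⟩
  · rintro ⟨a, h⟩
    refine ⟨extend n v [(a.unpair.1 : K), (a.unpair.2 : K)], agree_extend _ _ _, ?_⟩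
    have := isPair_cast (K := K) a.unpair.1 a.unpair.2
    simpa [extend_of_lt, hi, h] using this
  · rintro ⟨w, h, a, b, -, -, h'⟩
    exact ⟨_, (h i hi).symm.trans h'⟩

/-! ### Closure of definable graphs under the constructors of `Nat.Partrec` -/

/-- All the graphs of a partial function between registers are definable. -/
def GraphDefinable (K : Type*) [Ring K] [LinearOrder K] (f : ℕ →. ℕ) : Prop :=
  ∀ n i j : ℕ, i < n → j < n → Definable (K := K) n (fun v => Graph f (v i) (v j))

theorem GraphDefinable.comp {f g : ℕ →. ℕ} (hf : GraphDefinable K f) (hg : GraphDefinable K g) :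
    GraphDefinable K (fun a => g a >>= f) := by
  intro n i j hi hj
  refine (Definable.ex (r := 1) ((hg (n + 1) i n (by omega) (by omega)).and
    (hf (n + 1) n j (by omega) (by omega)))).of_iff fun v => ⟨?_, ?_⟩
  · rintro ⟨a, b, h1, h2, h3⟩
    obtain ⟨c, hc, hb⟩ := Part.mem_bind_iff.1 h3
    refine ⟨extend n v [(c : K)], agree_extend _ _ _, ?_⟩
    simpa [extend_of_lt, hi, hj, h1, h2] using ⟨graph_cast hc, graph_cast hb⟩
  · rintro ⟨w, h, ⟨a, c, h1, h2, h3⟩, h4⟩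
    rw [h2, h j hj] at h4
    obtain ⟨b, hb, h5⟩ := h4.exists_mem
    exact ⟨a, b, (h i hi).symm.trans h1, h5, Part.mem_bind_iff.2 ⟨c, h3, hb⟩⟩

theorem GraphDefinable.pair {f g : ℕ →. ℕ} (hf : GraphDefinable K f) (hg : GraphDefinable K g) :
    GraphDefinable K (fun a => Nat.pair <$> f a <*> g a) := by
  intro n i j hi hj
  refine (Definable.ex (r := 2) ((hf (n + 2) i n (by omega) (by omega)).and
    ((hg (n + 2) i (n + 1) (by omega) (by omega)).and
      (Definable.isPair (i := n) (j := n + 1) (k := j) (by omega) (by omega)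
        (by omega))))).of_iff fun v => ⟨?_, ?_⟩
  · rintro ⟨a, b, h1, h2, h3⟩
    simp only [Seq.seq, Part.map_eq_map, Part.mem_bind_iff, Part.mem_map_iff] at h3
    obtain ⟨_, ⟨x, hx, rfl⟩, y, hy, rfl⟩ := h3
    refine ⟨extend n v [(x : K), (y : K)], agree_extend _ _ _, ?_⟩
    simpa [extend_of_lt, hi, hj, h1, h2] using ⟨graph_cast hx, graph_cast hy, isPair_cast x y⟩
  · rintro ⟨w, h, ⟨a, x, h1, h2, h3⟩, h4, h5⟩
    rw [h1] at h4
    obtain ⟨y, hy, h6⟩ := h4.exists_mem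
    rw [h2, h6] at h5
    refine ⟨a, Nat.pair x y, (h i hi).symm.trans h1, (h j hj).symm.trans h5.eq, ?_⟩
    simp only [Seq.seq, Part.map_eq_map, Part.mem_bind_iff, Part.mem_map_iff]
    exact ⟨_, ⟨x, h3, rfl⟩, y, hy, rfl⟩

theorem GraphDefinable.prec {f g : ℕ →. ℕ} (hf : GraphDefinable K f) (hg : GraphDefinable K g) :
    GraphDefinable K (Nat.unpaired fun a n =>
      n.rec (f a) fun y IH => do let i ← IH; g (Nat.pair a (Nat.pair y i))) := by
  intro n i j hi hj
  -- Registers `n` and `n + 1` hold the parameter and the number of rounds. Registers `n + 2` and `n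
  -- + 3` hold the counter and the value of the recursion so far, and `n + 4` and `n + 5` their
  -- successors. The last two, `n + 6` and `n + 7`, hold the nested pairs that form the argument of
  -- `g`.
  have step : Definable (K := K) (n + 2 + 2 + 2) (fun v => v (n + 4) = v (n + 2) + 1 ∧
      ∃ w, Agree (n + 2 + 2 + 2) v w ∧ IsPair (w (n + 2)) (w (n + 3)) (w (n + 6)) ∧
        IsPair (w n) (w (n + 6)) (w (n + 7)) ∧ Graph g (w (n + 7)) (w (n + 5))) :=
    .and (.succ (by omega) (by omega)) (.ex (r := 2) (.and (.isPair (by omega) (by omega)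
      (by omega)) (.and (.isPair (by omega) (by omega) (by omega))
        (hg _ _ _ (by omega) (by omega)))))
  have loop := Definable.loop (n := n + 2) (r := 2)
    (ψ := fun v => v (n + 2) = 0 ∧ Graph f (v n) (v (n + 3)))
    (χ := fun v => v (n + 2) = v (n + 1) ∧ v (n + 3) = v j)
    (.and (.zero (by omega)) (hf _ _ _ (by omega) (by omega))) step
    (.and (.eq (by omega) (by omega)) (.eq (by omega) (by omega)))
  refine (Definable.ex (r := 2) ((Definable.isPair (i := n) (j := n + 1) (k := i) (by omega)
    (by omega) (by omega)).and loop)).of_iff fun v => ⟨?_, ?_⟩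
  · rintro ⟨c, b, h1, h2, h3⟩
    obtain ⟨⟨a, N⟩, rfl⟩ : ∃ x : ℕ × ℕ, Nat.pair x.1 x.2 = c := ⟨c.unpair, Nat.pair_unpair c⟩
    simp only [Nat.unpaired, Nat.unpair_pair] at h3
    refine ⟨extend n v [(a : K), (N : K)], agree_extend _ _ _, ?_, ?_⟩
    · simpa [extend_of_lt, hi, h1] using isPair_cast a N
    generalize hw : extend n v [(a : K), (N : K)] = w
    have hwn : w n = a := by simp [← hw]
    have key : ∀ (M b : ℕ), b ∈ (Nat.rec (f a) (fun y IH => do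
        let i ← IH; g (Nat.pair a (Nat.pair y i))) M : Part ℕ) → ∃ b₀ ∈ f a,
        ReflTransGen (LoopStep (n + 2) 2 fun v => v (n + 4) = v (n + 2) + 1 ∧
          ∃ w, Agree (n + 2 + 2 + 2) v w ∧ IsPair (w (n + 2)) (w (n + 3)) (w (n + 6)) ∧
            IsPair (w n) (w (n + 6)) (w (n + 7)) ∧ Graph g (w (n + 7)) (w (n + 5)))
          (extend (n + 2) w [0, (b₀ : K)]) (extend (n + 2) w [(M : K), (b : K)]) := by
      intro M
      induction M with
      | zero => exact fun b hb => ⟨b, hb, by rw [Nat.cast_zero]⟩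
      | succ M ih =>
        intro b hb
        obtain ⟨c, hc, hb⟩ := Part.mem_bind_iff.1 hb
        obtain ⟨b₀, hb₀, h⟩ := ih c hc
        refine ⟨b₀, hb₀, h.tail ⟨fun x hx => by simp only [extend_of_lt _ _ hx],
          extend (n + 2) w [(M : K), (c : K), ((M + 1 : ℕ) : K), (b : K)], ?_, ?_, ?_⟩⟩
        · intro x hx
          by_cases hx' : x < n + 2
          · simp only [extend_of_lt _ _ hx']
          · obtain ⟨y, rfl⟩ := Nat.exists_eq_add_of_le (not_lt.1 hx')
            have : y < 2 := by omega
            interval_cases y <;> simp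
        · refine ⟨by simp [extend], extend (n + 2 + 2 + 2) _
            [((Nat.pair M c : ℕ) : K), ((Nat.pair a (Nat.pair M c) : ℕ) : K)],
            agree_extend _ _ _, ?_⟩
          have h7 : ¬ n + 7 < n + 2 + 2 + 2 := by omega
          have h0 : n < n + 2 + 2 + 2 := by omega
          simpa [extend, hwn, h7, h0] using ⟨isPair_cast M c, isPair_cast a (Nat.pair M c), graph_cast hb⟩
        · intro x hx
          rw [add_assoc]
          interval_cases x
          · simp
          · simp [extend]
            exact fun h => by omega
    obtain ⟨b₀, hb₀, h⟩ := key N b h3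
    refine ⟨_, _, agree_extend (n + 2) w _, ?_, h, ?_⟩
    · simpa [extend, hwn] using graph_cast hb₀
    · have : j < n + 2 := by omega
      rw [extend_of_lt _ _ this, extend_of_lt _ _ (by omega : n + 1 < n + 2), ← hw,
        extend_of_lt _ _ hj, h2]
      simp [extend]
  · rintro ⟨w, h, ⟨a, N, h1, h2, h3⟩, w1, w2, h4, ⟨h5, h6⟩, h7, h8, h9⟩
    have h4' := h4.trans (LoopStep.agree h7)
    -- Loop invariant: the counter is a natural number `M`, and the accumulator is a value of the
    -- recursion after `M` rounds.
    have key : ∃ M b : ℕ, w2 (n + 2) = M ∧ w2 (n + 3) = b ∧ b ∈ (Nat.rec (f a) (fun y IH => do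
        let i ← IH; g (Nat.pair a (Nat.pair y i))) M : Part ℕ) := by
      clear h8 h9 h4'
      induction h7 with
      | refl =>
        rw [h4 n (by omega), h1] at h6
        obtain ⟨b, hb, h6⟩ := h6.exists_mem
        exact ⟨0, b, by simp [h5], h6, hb⟩
      | @tail x y hx hxy ih =>
        obtain ⟨M, c, e1, e2, hc⟩ := ih
        obtain ⟨-, u, hu, ⟨hs, z, hz, p1, p2, p3⟩, hu'⟩ := hxy
        have hx' := h4.trans (LoopStep.agree hx)
        rw [hz (n + 2) (by omega), hu (n + 2) (by omega), hz (n + 3) (by omega),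
          hu (n + 3) (by omega), e1, e2] at p1
        rw [hz n (by omega), hu n (by omega), hx' n (by omega), h1, p1.eq] at p2
        rw [p2.eq, hz (n + 5) (by omega)] at p3
        obtain ⟨b, hb, p3⟩ := p3.exists_mem
        refine ⟨M + 1, b, ?_, ?_, Part.mem_bind_iff.2 ⟨c, hc, hb⟩⟩
        · rw [show y (n + 2) = u (n + 4) from hu' 0 (by omega), hs, hu (n + 2) (by omega), e1]
          push_cast; rfl
        · rw [show y (n + 3) = u (n + 5) from hu' 1 (by omega), p3]
    obtain ⟨M, b, e1, e2, hb⟩ := key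
    have hM : M = N := by
      rw [e1, h4' (n + 1) (by omega), h2, Nat.cast_inj] at h8
      exact h8
    subst hM
    refine ⟨Nat.pair a M, b, by rw [← h i hi, h3], ?_, by simpa [Nat.unpaired] using hb⟩
    rw [← e2, h9, h4' j (by omega), h j hj]

theorem GraphDefinable.rfind {f : ℕ →. ℕ} (hf : GraphDefinable K f) :
    GraphDefinable K (fun a => Nat.rfind fun n => (fun m => m = 0) <$> f (Nat.pair a n)) := by
  intro n i j hi hj
  -- The counter in `n` may advance only past arguments where `f` is defined and nonzero. Registers
  -- `n + 2` and `n + 3` hold argument and value; `n + 4` holds zero, since comparisons are between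
  -- registers, and the value is a natural, so being nonzero means exceeding zero.
  have step : Definable (K := K) (n + 1 + 1) (fun v => v (n + 1) = v n + 1 ∧
      ∃ w, Agree (n + 1 + 1) v w ∧ IsPair (w i) (w n) (w (n + 2)) ∧
        Graph f (w (n + 2)) (w (n + 3)) ∧ w (n + 4) = 0 ∧ w (n + 4) < w (n + 3)) :=
    .and (.succ (by omega) (by omega)) (.ex (r := 3) (.and (.isPair (by omega) (by omega)
      (by omega)) (.and (hf _ _ _ (by omega) (by omega)) (.and (.zero (by omega))
        (.lt (by omega) (by omega))))))
  have final : Definable (K := K) (n + 1) (fun v => v n = v j ∧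
      ∃ w, Agree (n + 1) v w ∧ IsPair (w i) (w n) (w (n + 1)) ∧
        Graph f (w (n + 1)) (w (n + 2)) ∧ w (n + 2) = 0) :=
    .and (.eq (by omega) (by omega)) (.ex (r := 2) (.and (.isPair (by omega) (by omega)
      (by omega)) (.and (hf _ _ _ (by omega) (by omega)) (.zero (by omega)))))
  refine (Definable.loop (n := n) (r := 1) (ψ := fun v => v n = 0) (.zero (by omega)) step
    final).of_iff fun v => ⟨?_, ?_⟩
  · rintro ⟨a, b, h1, h2, h3⟩
    obtain ⟨h3, h4⟩ := Nat.mem_rfind.1 h3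
    have h3 : 0 ∈ f (Nat.pair a b) := by simpa using h3
    have key : ∀ m ≤ b, ReflTransGen (LoopStep n 1 fun v => v (n + 1) = v n + 1 ∧
        ∃ w, Agree (n + 1 + 1) v w ∧ IsPair (w i) (w n) (w (n + 2)) ∧
          Graph f (w (n + 2)) (w (n + 3)) ∧ w (n + 4) = 0 ∧ w (n + 4) < w (n + 3))
        (extend n v [0]) (extend n v [(m : K)]) := by
      intro m
      induction m with
      | zero => intro _; rw [Nat.cast_zero]
      | succ m ih =>
        intro hm
        obtain ⟨c, hc, hc'⟩ : ∃ c ∈ f (Nat.pair a m), c ≠ 0 := by simpa using h4 hm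
        refine (ih (by omega)).tail ⟨fun x hx => by simp only [extend_of_lt _ _ hx],
          extend n v [(m : K), ((m + 1 : ℕ) : K)], ?_, ⟨by simp, extend (n + 1 + 1) _
            [((Nat.pair a m : ℕ) : K), (c : K), 0], agree_extend _ _ _, ?_⟩, ?_⟩
        · intro x hx
          by_cases hx' : x < n
          · simp only [extend_of_lt _ _ hx']
          · obtain rfl : x = n := by omega
            simp
        · have hi' : i < n + 2 := by omega
          simpa [extend, hi, hi', h1, Nat.pos_iff_ne_zero.2 hc']
            using ⟨isPair_cast a m, graph_cast hc⟩
        · intro x hx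
          interval_cases x
          simp
    have hi' : i < n + 1 := by omega
    have h0 : Graph (K := K) f (Nat.pair a b : ℕ) 0 := by
      have := graph_cast (K := K) h3
      rwa [Nat.cast_zero] at this
    refine ⟨_, _, agree_extend n v _, by simp, key b le_rfl, by simp [extend_of_lt, hj, h2],
      extend (n + 1) _ [((Nat.pair a b : ℕ) : K), 0], agree_extend _ _ _, ?_⟩
    simpa [extend, hi, hi', h1] using ⟨isPair_cast a b, h0⟩
  · rintro ⟨w1, w2, h1, h2, h3, h4, z, hz, p1, p2, p3⟩
    have h5 := h1.trans (LoopStep.agree h3)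
    have hz' : z i = v i := by rw [hz i (by omega), h5 i hi]
    obtain ⟨a, m, e1, e2, e3⟩ := p1
    have ha : v i = a := hz'.symm.trans e1
    rw [e3] at p2
    obtain ⟨y, hy, p4⟩ := p2.exists_mem
    -- Loop invariant: the counter is a natural number, and `f` has a nonzero value at every smaller
    -- candidate.
    have key : ∃ m' : ℕ, w2 n = m' ∧ ∀ k < m', ∃ c ∈ f (Nat.pair a k), c ≠ 0 := by
      clear h4 hz h5
      induction h3 with
      | refl => exact ⟨0, by simp [h2], by simp⟩
      | @tail x x' hx hxx' ih =>
        obtain ⟨k, hk, ih⟩ := ih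
        obtain ⟨-, u, hu, ⟨hs, z, hz, q1, q2, q3, q4⟩, hu'⟩ := hxx'
        have hx' := h1.trans (LoopStep.agree hx)
        rw [hz i (by omega), hu i (by omega), hx' i hi, ha, hz n (by omega), hu n (by omega),
          hk] at q1
        rw [q1.eq] at q2
        obtain ⟨c, hc, q2⟩ := q2.exists_mem
        rw [q3, q2, Nat.cast_pos] at q4
        refine ⟨k + 1, ?_, fun l hl => ?_⟩
        · rw [show x' n = u (n + 1) from hu' 0 (by omega), hs, hu n (by omega), hk]
          push_cast; rfl
        · rcases Nat.lt_succ_iff_lt_or_eq.1 hl with hl | rfl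
          · exact ih l hl
          · exact ⟨c, hc, by omega⟩
    obtain ⟨m', hm, key⟩ := key
    rw [hz n (by omega), hm, Nat.cast_inj] at e2
    subst e2
    rw [p4, Nat.cast_eq_zero] at p3
    subst p3
    refine ⟨a, m', ha, by rw [← h5 j hj, ← h4, hm], Nat.mem_rfind.2 ⟨?_, fun {k} hk => ?_⟩⟩
    · simpa using hy
    · simpa using key k hk

/-- The graph of every partial recursive function is definable. -/
theorem graphDefinable_of_partrec {f : ℕ →. ℕ} (hf : Nat.Partrec f) : GraphDefinable K f := by
  induction hf with
  | zero =>
    intro n i j hi hj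
    -- A graph relates natural numbers only, so the input register has to be checked although its
    -- content does not affect the output.
    refine ((Definable.isNat hi).and (.zero hj)).of_iff fun v => ⟨?_, ?_⟩
    · rintro ⟨a, b, h1, h2, h3⟩
      have : b = 0 := Part.mem_some_iff.1 h3
      exact ⟨⟨a, h1⟩, by simp [h2, this]⟩
    · rintro ⟨⟨a, h1⟩, h2⟩
      exact ⟨a, 0, h1, by simp [h2], Part.mem_some_iff.2 rfl⟩
  | succ =>
    intro n i j hi hj
    refine ((Definable.isNat hi).and (.succ hj hi)).of_iff fun v => ⟨?_, ?_⟩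
    · rintro ⟨a, b, h1, h2, h3⟩
      obtain rfl : b = a + 1 := by simpa using h3
      exact ⟨⟨a, h1⟩, by simp [h1, h2]⟩
    · rintro ⟨⟨a, h1⟩, h2⟩
      exact ⟨a, a + 1, h1, by simp [h1, h2], by simp⟩
  | left =>
    intro n i j hi hj
    refine (Definable.ex (r := 1) (Definable.isPair (i := j) (j := n) (k := i) (by omega)
      (by omega) (by omega))).of_iff fun v => ⟨?_, ?_⟩
    · rintro ⟨a, b, h1, h2, h3⟩
      obtain rfl : b = a.unpair.1 := by simpa using h3
      refine ⟨extend n v [(a.unpair.2 : K)], agree_extend _ _ _, ?_⟩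
      simpa [extend_of_lt, hi, hj, h1, h2] using isPair_cast (K := K) a.unpair.1 a.unpair.2
    · rintro ⟨w, h, a, b, h1, h2, h3⟩
      exact ⟨Nat.pair a b, a, by rw [← h i hi, h3], by rw [← h j hj, h1], by simp⟩
  | right =>
    intro n i j hi hj
    refine (Definable.ex (r := 1) (Definable.isPair (i := n) (j := j) (k := i) (by omega)
      (by omega) (by omega))).of_iff fun v => ⟨?_, ?_⟩
    · rintro ⟨a, b, h1, h2, h3⟩
      obtain rfl : b = a.unpair.2 := by simpa using h3
      refine ⟨extend n v [(a.unpair.1 : K)], agree_extend _ _ _, ?_⟩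
      simpa [extend_of_lt, hi, hj, h1, h2] using isPair_cast (K := K) a.unpair.1 a.unpair.2
    · rintro ⟨w, h, a, b, h1, h2, h3⟩
      exact ⟨Nat.pair a b, b, by rw [← h i hi, h3], by rw [← h j hj, h2], by simp⟩
  | pair _ _ hf hg => exact hf.pair hg
  | comp _ _ hf hg => exact hf.comp hg
  | prec _ _ hf hg => exact hf.prec hg
  | rfind _ hf => exact hf.rfind

/-- The domain of every partial recursive function is the halting set of a register program that
starts with its input in register `0`. -/
theorem exists_program_of_partrec {f : ℕ →. ℕ} (hf : Nat.Partrec f) :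
    ∃ E : List Edge, ∀ (a : ℕ) (v : ℕ → K), v 0 = a →
      ((∃ w, ReflTransGen (EStep E) (1, v) (0, w)) ↔ (f a).Dom) := by
  -- The output is guessed in register `1`, so the test expresses definedness at the content of
  -- register `0`, whatever the other registers hold initially.
  obtain ⟨R, hR, hR1, hR2⟩ := (Definable.ex (r := 1)
    (graphDefinable_of_partrec (K := K) hf 2 0 1 (by omega) (by omega))).test
  obtain ⟨E, hE⟩ := hR.exists_program
  refine ⟨E, fun a v hv => ?_⟩
  simp only [hE]
  constructor
  · rintro ⟨w, hw⟩
    obtain ⟨⟨u, hu, h⟩, -⟩ := hR1 _ _ hw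
    rw [hu 0 (by omega), hv] at h
    obtain ⟨b, hb, -⟩ := h.exists_mem
    exact Part.dom_iff_mem.2 ⟨b, hb⟩
  · intro h
    obtain ⟨b, hb⟩ := Part.dom_iff_mem.1 h
    refine hR2 v ⟨extend 1 v [(b : K)], agree_extend _ _ _, ?_⟩
    simpa [extend, hv] using graph_cast hb

end RegisterProgram

/-! # The multiagent system of a register program -/

namespace RegisterProgram

open Rmas Relation

/-- The base facet of numbers. -/
def numFacet : Facet := ⟨.num, .tt⟩

/-- The proposition for a program point; the halting point `0` has the name `p`. -/
def pcRel (p ℓ : ℕ) : ℕ := if ℓ = 0 then p else p + 2 * ℓ + 4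

/-- The unary relation that stores the content of a register. -/
def regRel (p i : ℕ) : ℕ := p + 2 * i + 5

theorem le_pcRel (p ℓ : ℕ) : p ≤ pcRel p ℓ := by unfold pcRel; split <;> omega

theorem le_regRel (p i : ℕ) : p ≤ regRel p i := by unfold regRel; omega

@[simp] theorem pcRel_inj {p q ℓ : ℕ} : pcRel p q = pcRel p ℓ ↔ q = ℓ := by
  unfold pcRel; split_ifs <;> omega

@[simp] theorem regRel_inj {p i j : ℕ} : regRel p i = regRel p j ↔ i = j := by
  unfold regRel; omega

-- Relative to `p`, program points have even offsets and registers odd ones.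
@[simp] theorem pcRel_ne_regRel (p ℓ i : ℕ) : pcRel p ℓ ≠ regRel p i := by
  unfold pcRel regRel; split_ifs <;> omega

@[simp] theorem regRel_ne_pcRel (p ℓ i : ℕ) : regRel p i ≠ pcRel p ℓ :=
  (pcRel_ne_regRel p ℓ i).symm

/-- The query that tests whether an instruction can be executed. -/
def Instr.guard (p : ℕ) : Instr → Query
  | .havoc _ => .tt
  | .test r i j => .ex (.num 0) (.ex (.num 1) (.and
      (.and (.rel (regRel p i) [.var (.num 0)]) (.rel (regRel p j) [.var (.num 1)]))
      (.drel r (.var (.num 0)) (.var (.num 1)))))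
  | .isZero i => .rel (regRel p i) [.const (.num 0)]

/-- The effects that update the registers. -/
def Instr.effects (p : ℕ) : Instr → List Effect
  | .havoc i => [⟨.rel (regRel p i) [.var (.num 0)], [(regRel p i, [.call 0 []])],
      [(regRel p i, [.var (.num 0)])]⟩]
  | _ => []

/-- The communicative rule of an edge with number `k`. -/
def Edge.comm (p : ℕ) (e : Edge) (k : ℕ) : CommRule :=
  ⟨.and (.rel rAgent [.var (.agent 0)]) (.and (.rel (pcRel p e.src) []) (e.instr.guard p)),
    k, [], .agent 0⟩

/-- The update action of an edge with number `k`. -/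
def Edge.action (p : ℕ) (e : Edge) (k : ℕ) : Action :=
  ⟨k, [], ⟨.tt, [(pcRel p e.dst, [])], [(pcRel p e.src, [])]⟩ :: e.instr.effects p⟩

/-- The update rule that calls the action with number `k`. -/
def update (k : ℕ) : UpdateRule := ⟨true, k, [], .agent 0, .tt, k, []⟩

/-- The database schema for program points below `m` and registers below `k`. -/
def schema (p m k : ℕ) : List RelSchema :=
  [⟨rMyName, [AF]⟩, ⟨rAgent, [AF]⟩, ⟨rSpec, [BF]⟩, ⟨rHasSpec, [AF, BF]⟩] ++
    ((List.range m).map (fun ℓ => ⟨pcRel p ℓ, []⟩) ++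
      (List.range k).map fun i => ⟨regRel p i, [numFacet]⟩)

/-- The initial database, with the number `n` in all registers. -/
def initDb (p k n : ℕ) : List (ℕ × List Const) :=
  [(rMyName, [.agent instName]), (rAgent, [.agent instName]), (rSpec, [.spec ispecName]),
    (rHasSpec, [.agent instName, .spec ispecName]), (pcRel p 1, [])] ++
    (List.range k).map fun i => (regRel p i, [.num n])

/-- The institutional agent, which executes the program. -/
def instSpec (E : List Edge) (p m k n : ℕ) : AgentSpec where
  name := ispecName
  schema := schema p m k
  constraints := []
  initDb := initDb p k n
  comm := E.zipIdx.map fun x => x.1.comm p x.2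
  actions := E.zipIdx.map fun x => x.1.action p x.2
  updates := (List.range E.length).map update

/-- The multiagent system that consists of the institutional agent only. -/
def system (E : List Edge) (p m k n : ℕ) : RMAS where
  facets := [AF, BF, numFacet]
  initDom := [.agent instName, .spec ispecName, .num 0, .num n]
  services := [⟨0, [], numFacet⟩]
  messages := (List.range E.length).map fun i => ⟨i, []⟩
  specs := []
  inst := instSpec E p m k n

/-- The registers that occur in the instruction are below `k`. -/
def Instr.Below (k : ℕ) : Instr → Prop
  | .havoc i => i < k
  | .test _ i j => i < k ∧ j < k
  | .isZero i => i < k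

/-- All program points are below `m`, and all registers below `k`. -/
def Bounded (E : List Edge) (m k : ℕ) : Prop :=
  1 < m ∧ ∀ e ∈ E, e.src < m ∧ e.dst < m ∧ e.instr.Below k

theorem Instr.Below.mono {ins : Instr} {k k' : ℕ} (h : ins.Below k) (hk : k ≤ k') :
    ins.Below k' := by
  cases ins <;> simp only [Instr.Below] at * <;> omega

theorem Instr.exists_below (ins : Instr) : ∃ k, ins.Below k := by
  cases ins with
  | havoc i => exact ⟨i + 1, by simp [Instr.Below]⟩
  | test r i j => exact ⟨i + j + 1, by simp only [Instr.Below]; omega⟩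
  | isZero i => exact ⟨i + 1, by simp [Instr.Below]⟩

theorem exists_bounded (E : List Edge) : ∃ m k, Bounded E m k := by
  induction E with
  | nil => exact ⟨2, 0, by simp [Bounded]⟩
  | cons e E ih =>
    obtain ⟨m, k, hm, h⟩ := ih
    obtain ⟨k', hk'⟩ := e.instr.exists_below
    refine ⟨m + e.src + e.dst + 1, k + k', by omega, fun e' he' => ?_⟩
    rcases List.mem_cons.1 he' with rfl | he'
    · exact ⟨by omega, by omega, hk'.mono (by omega)⟩
    · have := h e' he'
      exact ⟨by omega, by omega, this.2.2.mono (by omega)⟩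

/-! ### Databases of program configurations -/

section database

variable {K : Type*} {p m k : ℕ}

/-- The database that records the program point `ℓ` and the contents `v` of the registers. -/
def db (p k ℓ : ℕ) (v : ℕ → K) : Instance K :=
  {(rMyName, [.agent instName]), (rAgent, [.agent instName]), (rSpec, [.spec ispecName]),
    hasSpecFact K instName ispecName, (pcRel p ℓ, [])} ∪
    {f | ∃ i < k, f = (regRel p i, [.num (v i)])}

theorem mem_db {ℓ : ℕ} {v : ℕ → K} {f : Fact K} : f ∈ db p k ℓ v ↔
    (f = (rMyName, [.agent instName]) ∨ f = (rAgent, [.agent instName]) ∨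
      f = (rSpec, [.spec ispecName]) ∨ f = (rHasSpec, [.agent instName, .spec ispecName]) ∨
      f = (pcRel p ℓ, [])) ∨ ∃ i < k, f = (regRel p i, [.num (v i)]) := Iff.rfl

theorem mem_db_pcRel {ℓ q : ℕ} {v : ℕ → K} :
    (pcRel p q, []) ∈ db p k ℓ v ↔ q = ℓ := by
  simp [mem_db]

theorem mem_db_regRel (hp : 4 ≤ p) {ℓ i : ℕ} {v : ℕ → K} {o : Obj K} :
    (regRel p i, [o]) ∈ db p k ℓ v ↔ i < k ∧ o = .num (v i) := by
  have := le_regRel p i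
  have h0 : regRel p i ≠ rMyName := by simp only [rMyName]; omega
  have h1 : regRel p i ≠ rAgent := by simp only [rAgent]; omega
  have h2 : regRel p i ≠ rSpec := by simp only [rSpec]; omega
  simp only [mem_db, Prod.mk.injEq, h0, h1, h2, List.cons.injEq, regRel_inj]
  simp

theorem mem_db_of_lt {ℓ R : ℕ} (hp : 4 ≤ p) (hR : R < 4) {v : ℕ → K} {l : List (Obj K)} :
    (R, l) ∈ db p k ℓ v ↔ (R = rMyName ∧ l = [.agent instName]) ∨
      (R = rAgent ∧ l = [.agent instName]) ∨ (R = rSpec ∧ l = [.spec ispecName]) ∨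
      (R = rHasSpec ∧ l = [.agent instName, .spec ispecName]) := by
  have h1 : R ≠ pcRel p ℓ := by have := le_pcRel p ℓ; omega
  have h2 : ∀ i, R ≠ regRel p i := fun i => by have := le_regRel p i; omega
  simp [mem_db, h1, h2]

theorem mem_db_rAgent (hp : 4 ≤ p) {ℓ : ℕ} {v : ℕ → K} {o : Obj K} :
    (rAgent, [o]) ∈ db p k ℓ v ↔ o = .agent instName := by
  rw [mem_db_of_lt hp (by decide)]
  simp [rMyName, rAgent, rSpec, rHasSpec]

theorem registryOf_db (hp : 4 ≤ p) (ℓ : ℕ) (v : ℕ → K) :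
    registryOf (db p k ℓ v) = {(instName, ispecName)} := by
  ext ⟨a, b⟩
  change hasSpecFact K a b ∈ db p k ℓ v ↔ _
  rw [hasSpecFact, mem_db_of_lt hp (by decide)]
  simp [rMyName, rAgent, rSpec, rHasSpec]

theorem adom_db_encard_le (ℓ : ℕ) (v : ℕ → K) : (adom (db p k ℓ v)).encard ≤ (k + 2 : ℕ) := by
  classical
  have : adom (db p k ℓ v) ⊆ (({.agent instName, .spec ispecName} : Finset (Obj K)) ∪
      (Finset.range k).image fun i => .num (v i) : Finset (Obj K)) := by
    rintro o ⟨f, hf, ho⟩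
    rcases mem_db.1 hf with (rfl | rfl | rfl | rfl | rfl) | ⟨i, hi, rfl⟩
    · simp_all
    · simp_all
    · simp_all
    · have : o = .agent instName ∨ o = .spec ispecName := by simpa using ho
      rcases this with rfl | rfl <;> simp
    · simp at ho
    · have : o = .num (v i) := by simpa using ho
      subst this
      simp only [Finset.coe_union, Finset.coe_image, Finset.coe_range]
      exact .inr ⟨i, hi, rfl⟩
  refine (Set.encard_le_encard this).trans ?_
  rw [Set.encard_coe_eq_coe_finsetCard]
  refine Nat.cast_le.2 ((Finset.card_union_le _ _).trans ?_)
  have h1 := Finset.card_le_two (a := (.agent instName : Obj K)) (b := .spec ispecName)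
  have h2 := Finset.card_image_le (s := Finset.range k) (f := fun i => (.num (v i) : Obj K))
  rw [Finset.card_range] at h2
  omega

variable [Ring K]

theorem initial_instSpec (E : List Edge) (n : ℕ) :
    (instSpec E p m k n).initial K = db p k 1 fun _ => (n : K) := by
  ext f
  rw [mem_db]
  simp only [AgentSpec.initial, instSpec, initDb, Set.mem_ofPred_eq, List.mem_append,
    List.mem_map, List.mem_range, List.mem_cons, List.not_mem_nil, or_false]
  constructor
  · rintro ⟨g, (rfl | rfl | rfl | rfl | rfl) | ⟨i, hi, rfl⟩, rfl⟩
    · simp [Const.den]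
    · simp [Const.den]
    · simp [Const.den]
    · simp [Const.den]
    · simp
    · exact .inr ⟨i, hi, by simp [Const.den]⟩
  · rintro ((rfl | rfl | rfl | rfl | rfl) | ⟨i, hi, rfl⟩)
    · exact ⟨(rMyName, [.agent instName]), by simp, rfl⟩
    · exact ⟨(rAgent, [.agent instName]), by simp, rfl⟩
    · exact ⟨(rSpec, [.spec ispecName]), by simp, rfl⟩
    · exact ⟨(rHasSpec, [.agent instName, .spec ispecName]), by simp, rfl⟩
    · exact ⟨(pcRel p 1, []), by simp, rfl⟩
    · exact ⟨(regRel p i, [.num n]), .inr ⟨i, hi, rfl⟩, by simp [Const.den]⟩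

variable [LinearOrder K]

theorem conforms_db {ℓ : ℕ} (hℓ : ℓ < m) (v : ℕ → K) :
    Conforms (schema p m k) (db p k ℓ v) := by
  intro f hf
  have hA : Facet.Mem (K := K) AF (.agent instName) := ⟨rfl, trivial⟩
  have hB : Facet.Mem (K := K) BF (.spec ispecName) := ⟨rfl, trivial⟩
  rcases mem_db.1 hf with (rfl | rfl | rfl | rfl | rfl) | ⟨i, hi, rfl⟩
  · exact ⟨⟨rMyName, [AF]⟩, by simp [schema], rfl, .cons hA .nil⟩
  · exact ⟨⟨rAgent, [AF]⟩, by simp [schema], rfl, .cons hA .nil⟩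
  · exact ⟨⟨rSpec, [BF]⟩, by simp [schema], rfl, .cons hB .nil⟩
  · exact ⟨⟨rHasSpec, [AF, BF]⟩, by simp [schema], rfl, .cons hA (.cons hB .nil)⟩
  · exact ⟨⟨pcRel p ℓ, []⟩, by simp [schema, hℓ], rfl, .nil⟩
  · exact ⟨⟨regRel p i, [numFacet]⟩, by simp [schema, hi], rfl, .cons ⟨rfl, trivial⟩ .nil⟩

/-- The semantic counterpart of the guard. -/
def Instr.Enabled : Instr → (ℕ → K) → Prop
  | .havoc _, _ => True
  | .test r i j, v => r.Holds (.num (v i)) (.num (v j))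
  | .isZero i, v => v i = 0

/-- Each register relation contains exactly one number, so the quantified variables of the guard can
only denote register contents. -/
theorem sat_guard (hp : 4 ≤ p) {ins : Instr} (h : ins.Below k) (ℓ : ℕ) (v : ℕ → K)
    (x : Var → Obj K) : (ins.guard p).Sat (db p k ℓ v) x ↔ ins.Enabled v := by
  cases ins with
  | havoc i => exact Iff.rfl
  | test r i j =>
    simp only [Query.Sat, Instr.guard, Query.SatIn, List.map, Term.eval, mem_db_regRel hp, h.1,
      h.2, Set.mem_univ, true_and, Instr.Enabled]
    constructor
    · rintro ⟨o, -, o', -, ⟨h1, h2⟩, h3⟩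
      rwa [h1, h2] at h3
    · intro h
      refine ⟨.num (v i), rfl, .num (v j), rfl, ⟨?_, ?_⟩, ?_⟩ <;> simp [Function.update, h]
  | isZero i =>
    have h : i < k := h
    simp [Query.Sat, Instr.guard, Query.SatIn, List.map, Term.eval, mem_db_regRel hp, h,
      Instr.Enabled, Const.den, eq_comm]

/-- This is what makes guards domain independent: each quantified variable occurs in a register
atom, hence its witnesses lie in the active domain of any database. -/
theorem satIn_guard {ins : Instr} {D : Instance K} {U : Set (Obj K)} (hU : adom D ⊆ U)
    (x : Var → Obj K) : (ins.guard p).SatIn U D x ↔ (ins.guard p).Sat D x := by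
  cases ins with
  | havoc i => exact Iff.rfl
  | test r i j =>
    constructor
    · rintro ⟨o, -, ho, o', -, h⟩
      exact ⟨o, trivial, ho, o', trivial, h⟩
    · rintro ⟨o, -, ho, o', -, ho', ⟨h1, h2⟩, h3⟩
      exact ⟨o, hU ⟨_, h1, by simp [Term.eval, Function.update]⟩, ho, o',
        hU ⟨_, h2, by simp [Term.eval]⟩, ho', ⟨h1, h2⟩, h3⟩
  | isZero i => exact Iff.rfl

end database

end RegisterProgram

/-! # The transition system of a register program -/

namespace RegisterProgram

open Rmas Relation

variable {K : Type*} {p m k : ℕ}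

/-- The state in which the institutional agent is at the program point `ℓ` with registers `v`. -/
def state (p k ℓ : ℕ) (v : ℕ → K) : State K :=
  fun a => if a = instName then some (db p k ℓ v) else none

@[simp] theorem state_instName (ℓ : ℕ) (v : ℕ → K) :
    state p k ℓ v instName = some (db p k ℓ v) := if_pos rfl

theorem state_ne_none {ℓ a : ℕ} {v : ℕ → K} : state p k ℓ v a ≠ none ↔ a = instName := by
  unfold state; split_ifs with h <;> simp [h]

theorem curAS_state (hp : 4 ≤ p) (ℓ : ℕ) (v : ℕ → K) :
    curAS (state p k ℓ v) = {(instName, ispecName)} := by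
  rw [← registryOf_db (k := k) hp ℓ v]
  ext x
  simp [curAS]

variable [Ring K]

theorem initState_system (hp : 4 ≤ p) (E : List Edge) (n : ℕ) :
    initState (system E p m k n) K = state p k 1 fun _ => (n : K) := by
  funext a
  simp only [initState, freshDb, RMAS.allSpecs]
  rw [show (system E p m k n).inst = instSpec E p m k n from rfl,
    show (system E p m k n).specs = [] from rfl, initial_instSpec, registryOf_db hp]
  have hn : (instSpec E p m k n).name = ispecName := rfl
  by_cases ha : a = instName
  · simp [hn, ha, initial_instSpec]
  · simp [ha, state]

/-- The agent is both sender and receiver. Its database as a sender takes precedence, so the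
database `D` that it would have as a receiver is irrelevant. -/
theorem nextState_state (hp : 4 ≤ p) (X : RMAS) (ℓ ℓ' : ℕ) (v w : ℕ → K) (D : Instance K) :
    nextState X (state p k ℓ v) instName instName (db p k ℓ' w) D = state p k ℓ' w := by
  funext a
  by_cases ha : a = instName <;> simp [nextState, registryOf_db hp, state, ha]

/-- Every variable is assigned an object of its type; all agent variables are assigned `inst`. -/
def valuation (K : Type*) [Ring K] : Var → Obj K
  | .agent _ => .agent instName
  | .spec _ => .spec ispecName
  | .num _ => .num 0

theorem typed_valuation : Typed (valuation K) := by
  rintro (n | n | n) <;> rfl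

/-! ### Transitions of the system against steps of the program -/

variable [LinearOrder K]

theorem mem_enabledMsgs (hp : 4 ≤ p) {E : List Edge} (hE : Bounded E m k) {n ℓ b : ℕ}
    {v : ℕ → K} {M : Fact K} :
    (M, b) ∈ enabledMsgs (system E p m k n) (instSpec E p m k n) (db p k ℓ v) ↔
      b = instName ∧ ∃ (e : Edge) (i : ℕ), (e, i) ∈ E.zipIdx ∧ M = (i, []) ∧ e.src = ℓ ∧
        e.instr.Enabled v := by
  constructor
  · rintro ⟨c, hc, x, hx, hq, hb, hM, -⟩
    obtain ⟨⟨e, i⟩, he, rfl⟩ := List.mem_map.1 hc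
    obtain ⟨h1, h2, h3⟩ := hq
    have h1 : x (.agent 0) = _ := (mem_db_rAgent hp).1 h1
    rw [show x (.agent 0) = _ from hb] at h1
    exact ⟨Obj.agent.inj h1, e, i, he, hM, mem_db_pcRel.1 h2,
      (sat_guard hp (hE.2 e (List.fst_mem_of_mem_zipIdx he)).2.2 ℓ v x).1 h3⟩
  · rintro ⟨rfl, e, i, he, rfl, rfl, h⟩
    refine ⟨e.comm p i, List.mem_map.2 ⟨(e, i), he, rfl⟩, valuation K, typed_valuation,
      ⟨(mem_db_rAgent hp).2 rfl, mem_db_pcRel.2 rfl,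
      (sat_guard hp (hE.2 e (List.fst_mem_of_mem_zipIdx he)).2.2 _ v _).2 h⟩, rfl, rfl,
      ⟨i, []⟩, ?_, rfl, .nil⟩
    have := List.snd_lt_of_mem_zipIdx he
    simpa [system] using this

/-- Messages, update rules and actions are numbered by positions in the list of edges, so the
message determines its action even if an edge occurs twice in the list. -/
theorem triggered_onSend {E : List Edge} {n i : ℕ} {e : Edge} (he : (e, i) ∈ E.zipIdx)
    (D : Instance K) :
    triggered (instSpec E p m k n) D true (i, []) instName = {(e.action p i, [])} := by
  ext ⟨α, l⟩
  simp only [Set.mem_singleton_iff, Prod.mk.injEq]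
  constructor
  · rintro ⟨u, hu, -, hi, x, -, -, -, -, hα, hn, hl, -⟩
    obtain ⟨j, -, rfl⟩ := List.mem_map.1 hu
    obtain ⟨⟨e', i'⟩, he', rfl⟩ := List.mem_map.1 hα
    have hi : j = i := hi
    have hn : i' = j := hn
    subst hn hi
    rw [List.mk_mem_zipIdx_iff_getElem?] at he he'
    rw [he, Option.some_inj] at he'
    exact ⟨by rw [he'], hl⟩
  · rintro ⟨rfl, rfl⟩
    have := List.snd_lt_of_mem_zipIdx he
    exact ⟨update i, List.mem_map.2 ⟨i, by simpa using this, rfl⟩, rfl, rfl, valuation K,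
      typed_valuation, rfl, rfl, trivial, List.mem_map.2 ⟨(e, i), he, rfl⟩, rfl, rfl, .nil⟩

theorem triggered_onReceive {E : List Edge} {n b : ℕ} (D : Instance K) (M : Fact K) :
    triggered (instSpec E p m k n) D false M b = ∅ := by
  refine Set.eq_empty_of_forall_notMem ?_
  rintro x ⟨u, hu, h, -⟩
  obtain ⟨j, -, rfl⟩ := List.mem_map.1 hu
  cases h

theorem mem_toDel (hp : 4 ≤ p) {e : Edge} (he : e.instr.Below k) {i ℓ : ℕ} {v : ℕ → K}
    {f : Fact K} : f ∈ toDel (db p k ℓ v) {(e.action p i, [])} ↔ f = (pcRel p e.src, []) ∨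
      ∃ j, e.instr = .havoc j ∧ f = (regRel p j, [.num (v j)]) := by
  constructor
  · rintro ⟨_, rfl, ef, hef, x, -, -, hq, d, hd, rfl⟩
    rcases List.mem_cons.1 hef with rfl | hef
    · rw [List.mem_singleton.1 hd]
      exact .inl rfl
    · cases h : e.instr with
      | havoc j =>
        rw [h] at hef he
        rw [List.mem_singleton.1 hef] at hq hd
        rw [List.mem_singleton.1 hd]
        refine .inr ⟨j, rfl, ?_⟩
        have := ((mem_db_regRel hp).1 hq).2
        simpa using this
      | test r a b => rw [h] at hef; cases hef
      | isZero a => rw [h] at hef; cases hef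
  · rintro (rfl | ⟨j, h, rfl⟩)
    · exact ⟨_, rfl, _, List.mem_cons_self .., valuation K, typed_valuation, rfl, trivial, _,
        List.mem_singleton_self _, rfl⟩
    · rw [h] at he
      refine ⟨_, rfl, ⟨.rel (regRel p j) [.var (.num 0)], [(regRel p j, [.call 0 []])],
        [(regRel p j, [.var (.num 0)])]⟩, List.mem_cons_of_mem _ (by simp [h, Instr.effects]),
        Function.update (valuation K) (.num 0) (.num (v j)), ?_, rfl, ?_, _,
        List.mem_singleton_self _, ?_⟩
      · intro y
        by_cases hy : y = .num 0
        · subst hy; simp [Obj.ty, Var.ty]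
        · rw [Function.update_of_ne hy]; exact typed_valuation y
      · exact (mem_db_regRel hp).2 ⟨he, by simp [Term.eval]⟩
      · simp [Term.eval]

theorem mem_toAdd (hp : 4 ≤ p) {e : Edge} (he : e.instr.Below k) {i ℓ : ℕ} {v : ℕ → K}
    {f : PFact K} : f ∈ toAdd (db p k ℓ v) {(e.action p i, [])} ↔ f = (pcRel p e.dst, []) ∨
      ∃ j, e.instr = .havoc j ∧ f = (regRel p j, [.call (0, [])]) := by
  constructor
  · rintro ⟨_, rfl, ef, hef, x, -, -, hq, d, hd, rfl⟩
    rcases List.mem_cons.1 hef with rfl | hef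
    · rw [List.mem_singleton.1 hd]
      exact .inl rfl
    · cases h : e.instr with
      | havoc j =>
        rw [h] at hef he
        rw [List.mem_singleton.1 hef] at hq hd
        rw [List.mem_singleton.1 hd]
        exact .inr ⟨j, rfl, rfl⟩
      | test r a b => rw [h] at hef; cases hef
      | isZero a => rw [h] at hef; cases hef
  · rintro (rfl | ⟨j, h, rfl⟩)
    · exact ⟨_, rfl, _, List.mem_cons_self .., valuation K, typed_valuation, rfl, trivial, _,
        List.mem_singleton_self _, rfl⟩
    · rw [h] at he
      refine ⟨_, rfl, ⟨.rel (regRel p j) [.var (.num 0)], [(regRel p j, [.call 0 []])],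
        [(regRel p j, [.var (.num 0)])]⟩, List.mem_cons_of_mem _ (by simp [h, Instr.effects]),
        Function.update (valuation K) (.num 0) (.num (v j)), ?_, rfl, ?_, _,
        List.mem_singleton_self _, rfl⟩
      · intro y
        by_cases hy : y = .num 0
        · subst hy; simp [Obj.ty, Var.ty]
        · rw [Function.update_of_ne hy]; exact typed_valuation y
      · exact (mem_db_regRel hp).2 ⟨he, by simp [Term.eval]⟩

theorem mem_calls (hp : 4 ≤ p) {e : Edge} (he : e.instr.Below k) {i : ℕ} {v : ℕ → K}
    {c : GCall K} : c ∈ calls (pending (db p k e.src v) {(e.action p i, [])}) ↔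
      c = (0, []) ∧ ∃ j, e.instr = .havoc j := by
  constructor
  · rintro ⟨f, ⟨g, -, rfl⟩ | hf, hc⟩
    · simp at hc
    · rcases (mem_toAdd hp he).1 hf with rfl | ⟨j, hj, rfl⟩
      · simp at hc
      · exact ⟨by simpa using hc, j, hj⟩
  · rintro ⟨rfl, j, hj⟩
    exact ⟨_, .inr ((mem_toAdd hp he).2 (.inr ⟨j, hj, rfl⟩)), by simp⟩

theorem calls_pending_empty (D : Instance K) : calls (pending D ∅) = ∅ := by
  refine Set.eq_empty_of_forall_notMem ?_
  rintro c ⟨f, ⟨g, -, rfl⟩ | ⟨_, h, -⟩, hc⟩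
  · simp at hc
  · exact h

/-- An edge issues at most one ground call, `(0, [])`, and only for a guess; so a single value of
`θ` describes the new database, and all other registers are carried over. -/
theorem substDb_pending (hp : 4 ≤ p) {e : Edge} (he : e.instr.Below k) {i : ℕ} {v w : ℕ → K}
    {θ : GCall K → Obj K} (hw : ∀ j < k, (e.instr = .havoc j ∧ θ (0, []) = .num (w j)) ∨
      (e.instr ≠ .havoc j ∧ w j = v j)) :
    substDb θ (pending (db p k e.src v) {(e.action p i, [])}) = db p k e.dst w := by
  have hobj : ∀ f : Fact K, (f.1, (f.2.map GTerm.obj).map (GTerm.subst θ)) = f := by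
    rintro ⟨R, l⟩
    simp [GTerm.subst, Function.comp_def]
  ext f
  constructor
  · rintro ⟨_, ⟨g, ⟨hg, hg'⟩, rfl⟩ | hg, rfl⟩
    · rw [hobj]
      rw [mem_toDel hp he, not_or, not_exists] at hg'
      rcases mem_db.1 hg with (h | h | h | h | h) | ⟨j, hj, rfl⟩
      · exact mem_db.2 (by simp [h])
      · exact mem_db.2 (by simp [h])
      · exact mem_db.2 (by simp [h])
      · exact mem_db.2 (by simp [h])
      · exact absurd h hg'.1
      · rcases hw j hj with ⟨h, -⟩ | ⟨-, h⟩
        · exact absurd ⟨h, rfl⟩ (hg'.2 j)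
        · exact (mem_db_regRel hp).2 ⟨hj, by rw [h]⟩
    · rcases (mem_toAdd hp he).1 hg with rfl | ⟨j, hj, rfl⟩
      · exact mem_db_pcRel.2 rfl
      · rw [hj] at he
        rcases hw j he with ⟨-, h⟩ | ⟨h, -⟩
        · exact (mem_db_regRel hp).2 ⟨he, by simpa [GTerm.subst] using h⟩
        · exact absurd hj h
  · intro hf
    have hbase : ∀ R l, R < 4 → (R, l) ∈ db p k e.dst w →
        (R, l) ∈ substDb θ (pending (db p k e.src v) {(e.action p i, [])}) := by
      intro R l hR h
      rw [mem_db_of_lt hp hR, ← mem_db_of_lt (v := v) (ℓ := e.src) (k := k) hp hR] at h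
      refine ⟨_, .inl ⟨_, ⟨h, fun h' => ?_⟩, rfl⟩, (hobj _).symm⟩
      rcases (mem_toDel hp he).1 h' with h' | ⟨j, -, h'⟩
      · have h1 : R = _ := (Prod.mk.inj h').1
        have := le_pcRel p e.src
        omega
      · have h1 : R = _ := (Prod.mk.inj h').1
        have := le_regRel p j
        omega
    rcases mem_db.1 hf with (rfl | rfl | rfl | rfl | rfl) | ⟨j, hj, rfl⟩
    · exact hbase _ _ (by decide) hf
    · exact hbase _ _ (by decide) hf
    · exact hbase _ _ (by decide) hf
    · exact hbase _ _ (by decide) hf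
    -- Priority of additions matters here: if an edge returns to its source, the proposition that it
    -- deletes is added again.
    · exact ⟨_, .inr ((mem_toAdd hp he).2 (.inl rfl)), rfl⟩
    · rcases hw j hj with ⟨h, h'⟩ | ⟨h, h'⟩
      · exact ⟨_, .inr ((mem_toAdd hp he).2 (.inr ⟨j, h, rfl⟩)), by simp [GTerm.subst, h']⟩
      · refine ⟨_, .inl ⟨_, ⟨(mem_db_regRel hp (o := .num (v j))).2 ⟨hj, rfl⟩, fun hd => ?_⟩, rfl⟩,
          by rw [h']; exact (hobj _).symm⟩
        rcases (mem_toDel hp he).1 hd with hd | ⟨j', hj', hd⟩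
        · simp at hd
        · simp only [Prod.mk.injEq, regRel_inj] at hd
          exact h (hd.1 ▸ hj')

/-- One exchange of a message is one step of the program: the guard enables exactly the executable
edges, and the arbitrary answer of the service is the guessed content. -/
theorem step_iff (hp : 4 ≤ p) {E : List Edge} (hE : Bounded E m k) {n ℓ : ℕ} {v : ℕ → K}
    {s : State K} : Step (system E p m k n) (state p k ℓ v) s ↔
      ∃ ℓ' w, EStep E (ℓ, v) (ℓ', w) ∧ s = state p k ℓ' w := by
  -- No rollback occurs: there are no constraints, and the databases of configurations conform to
  -- the schema.
  have hcommit : ∀ (e : Edge), e ∈ E → ∀ (D : Instance K) (w : ℕ → K),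
      commit (instSpec E p m k n) D (db p k e.dst w) = db p k e.dst w := by
    intro e he D w
    refine if_pos ⟨conforms_db (hE.2 e he).2.1 w, ?_⟩
    rintro q hq
    cases hq
  constructor
  · rintro ⟨a, b, A, B, Da, Db, M, θ, hA, ha, hDa, hB, hb, hDb, hM, hθ, rfl⟩
    obtain rfl : A = instSpec E p m k n := by simpa [RMAS.allSpecs, system] using hA
    obtain rfl : B = instSpec E p m k n := by simpa [RMAS.allSpecs, system] using hB
    rw [curAS_state hp] at ha hb
    obtain rfl : a = instName := (Prod.mk.inj ha).1
    obtain rfl : b = instName := (Prod.mk.inj hb).1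
    rw [state_instName, Option.some_inj] at hDa hDb
    subst hDa hDb
    obtain ⟨-, e, i, he, rfl, rfl, hen⟩ := (mem_enabledMsgs hp hE).1 hM
    have heE := List.fst_mem_of_mem_zipIdx he
    have hk := (hE.2 e heE).2.2
    rw [triggered_onSend he] at hθ ⊢
    have key : ∀ w, e.instr.Sem v w → (∀ j < k, (e.instr = .havoc j ∧ θ (0, []) = .num (w j)) ∨
        (e.instr ≠ .havoc j ∧ w j = v j)) → ∀ D, ∃ ℓ' w, EStep E (e.src, v) (ℓ', w) ∧
        nextState (system E p m k n) (state p k e.src v) instName instName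
          (commit (instSpec E p m k n) (db p k e.src v)
            (substDb θ (pending (db p k e.src v) {(e.action p i, [])}))) D = state p k ℓ' w := by
      intro w h1 h2 D
      rw [substDb_pending hp hk h2, hcommit e heE, nextState_state hp]
      exact ⟨_, w, ⟨e, heE, rfl, rfl, h1⟩, rfl⟩
    cases hi : e.instr with
    | havoc j =>
      -- The output facet of the service forces the answer to be a number, which is the guessed
      -- content.
      obtain ⟨g, hg, -, -, hty, -⟩ := hθ (0, [])
        ⟨_, .inl (.inr ((mem_toAdd hp hk).2 (.inr ⟨j, hi, rfl⟩))), by simp⟩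
      obtain rfl : g = ⟨0, [], numFacet⟩ := by simpa [system] using hg
      obtain ⟨a, ha⟩ : ∃ a, θ (0, []) = .num a := by
        cases h : θ (0, []) with
        | num a => exact ⟨a, rfl⟩
        | agent a => rw [h] at hty; cases hty
        | spec a => rw [h] at hty; cases hty
      refine key (Function.update v j a) (by rw [hi]; exact ⟨a, rfl⟩) (fun j' _ => ?_) _
      by_cases hj : j' = j
      · subst hj
        exact .inl ⟨hi, by simpa using ha⟩
      · exact .inr ⟨by simpa [hi] using fun h => hj h.symm, by simp [hj]⟩
    | test r a b =>
      rw [hi] at hen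
      exact key v (by rw [hi]; exact ⟨rfl, hen⟩) (fun j _ => .inr (by simp [hi])) _
    | isZero a =>
      rw [hi] at hen
      exact key v (by rw [hi]; exact ⟨rfl, hen⟩) (fun j _ => .inr (by simp [hi])) _
  · rintro ⟨ℓ', w, ⟨e, heE, rfl, rfl, hsem⟩, rfl⟩
    obtain ⟨i, hi⟩ := List.getElem?_of_mem heE
    have he : (e, i) ∈ E.zipIdx := List.mk_mem_zipIdx_iff_getElem?.2 hi
    have hk := (hE.2 e heE).2.2
    -- Here `a` is the answer that the service must give: the guessed content if there is a guess,
    -- and otherwise an arbitrary number, as no call is issued.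
    obtain ⟨hen, a, ha⟩ : e.instr.Enabled v ∧ ∃ a : K, ∀ j,
        (e.instr = .havoc j ∧ a = w j) ∨ (e.instr ≠ .havoc j ∧ w j = v j) := by
      cases h : e.instr with
      | havoc j =>
        rw [h] at hsem
        obtain ⟨a, rfl⟩ : ∃ a, w = Function.update v j a := hsem
        refine ⟨trivial, a, fun j' => ?_⟩
        by_cases hj : j' = j
        · subst hj
          exact .inl ⟨rfl, by simp⟩
        · exact .inr ⟨by simpa using fun h => hj h.symm, by simp [hj]⟩
      | test r a b =>
        rw [h] at hsem
        obtain ⟨rfl, h⟩ := hsem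
        exact ⟨h, 0, fun j => .inr ⟨by simp, rfl⟩⟩
      | isZero a =>
        rw [h] at hsem
        obtain ⟨rfl, h⟩ := hsem
        exact ⟨h, 0, fun j => .inr ⟨by simp, rfl⟩⟩
    have hcur : (instName, (instSpec E p m k n).name) ∈ curAS (state p k e.src v) := by
      rw [curAS_state hp]; rfl
    refine ⟨instName, instName, instSpec E p m k n, instSpec E p m k n, _, _, (i, []),
      fun _ => .num a, List.mem_cons_self .., hcur, state_instName _ _, List.mem_cons_self ..,
      hcur, state_instName _ _, (mem_enabledMsgs hp hE).2 ⟨rfl, e, i, he, rfl, rfl, hen⟩, ?_, ?_⟩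
    · rintro c ⟨f, hf | hf, hc⟩
      · rw [triggered_onSend he] at hf
        obtain ⟨rfl, -⟩ := (mem_calls hp hk).1 ⟨f, hf, hc⟩
        exact ⟨⟨0, [], numFacet⟩, by simp [system], rfl, .nil, rfl, trivial⟩
      · rw [triggered_onReceive] at hf
        have : c ∈ calls (pending (db p k e.src v) ∅) := ⟨f, hf, hc⟩
        rw [calls_pending_empty] at this
        exact this.elim
    · rw [triggered_onSend he, substDb_pending (w := w) hp hk, hcommit e heE, nextState_state hp]
      intro j _
      exact (ha j).imp (fun h => ⟨h.1, by rw [h.2]⟩) id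

theorem reachable_iff (hp : 4 ≤ p) {E : List Edge} (hE : Bounded E m k) {n : ℕ} {s : State K} :
    Reachable (system E p m k n) s ↔ ∃ ℓ w,
      ReflTransGen (EStep E) (1, fun _ => (n : K)) (ℓ, w) ∧ s = state p k ℓ w := by
  rw [Reachable, initState_system hp]
  constructor
  · intro h
    induction h with
    | refl => exact ⟨1, _, .refl, rfl⟩
    | tail _ h ih =>
      obtain ⟨ℓ, w, hr, rfl⟩ := ih
      obtain ⟨ℓ', w', h', rfl⟩ := (step_iff hp hE).1 h
      exact ⟨ℓ', w', hr.tail h', rfl⟩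
  · rintro ⟨ℓ, w, h, rfl⟩
    generalize hc : (ℓ, w) = c at h
    have : ReflTransGen (Step (system E p m k n)) (state p k 1 fun _ => (n : K))
        (state p k c.1 c.2) := by
      clear hc
      induction h with
      | refl => exact .refl
      | tail _ h ih => exact ih.tail ((step_iff hp hE).2 ⟨_, _, h, rfl⟩)
    rw [← hc] at this
    exact this

/-! ### The reachability property as reachability in the transition system -/

/-- The proposition `q` holds at the institutional agent in the state `s`. -/
def HoldsAtInst (q : ℕ) (s : State K) : Prop :=
  (∃ D, s instName = some D ∧ (rAgent, [.agent instName]) ∈ D) ∧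
    ∃ D, s instName = some D ∧ (q, []) ∈ D

omit [Ring K] [LinearOrder K] in
theorem holdsAtInst_state (hp : 4 ≤ p) {ℓ : ℕ} {v : ℕ → K} :
    HoldsAtInst p (state p k ℓ v) ↔ ℓ = 0 := by
  have h : (p, []) ∈ db p k ℓ v ↔ 0 = ℓ := mem_db_pcRel (q := 0)
  simp [HoldsAtInst, h, mem_db_rAgent hp, eq_comm]

/-- The reachability property says that a state with the proposition is reachable. -/
theorem models_reach_iff (X : RMAS) (q : ℕ) :
    X.Models K (reach q) ↔ ∃ s : State K, Reachable X s ∧ HoldsAtInst q s := by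
  have hsem : ∀ (S : Set (State K)) (s : State K),
      s ∈ (MuForm.or (.prop q instName) (.dia (.pvar 0))).sem X K
        (Function.update (fun _ => ∅) 0 S) ↔ HoldsAtInst q s ∨ ∃ s', Step X s s' ∧ s' ∈ S := by
    intro S s
    rw [MuForm.or]
    simp only [MuForm.sem, Set.mem_compl_iff, Set.mem_inter_iff, not_and_or, not_not,
      Function.update_self]
    exact Iff.rfl
  have hmod : X.Models K (reach q) ↔ ∀ S : Set (State K),
      (∀ s, (HoldsAtInst q s ∨ ∃ s', Step X s s' ∧ s' ∈ S) → s ∈ S) → initState X K ∈ S := by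
    simp only [← hsem]
    exact Iff.rfl
  rw [hmod]
  constructor
  · intro h
    -- The least fixpoint lies in every prefixed point, in particular in the set of states from
    -- which the proposition can be reached.
    refine h {s | ∃ s', ReflTransGen (Step X) s s' ∧ HoldsAtInst q s'} ?_
    rintro s (hs | ⟨s', hs, s'', hs', h⟩)
    · exact ⟨s, .refl, hs⟩
    · exact ⟨s'', .head hs hs', h⟩
  · rintro ⟨s, hs, hq⟩ S hS
    have hs : ReflTransGen (Step X) (initState X K) s := hs
    generalize initState X K = s₀ at hs
    -- Conversely, every prefixed point contains the goal state and, going backwards along the path,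
    -- all its predecessors.
    induction hs using ReflTransGen.head_induction_on with
    | refl => exact hS _ (.inl hq)
    | head h _ ih => exact hS _ (.inr ⟨_, h, ih⟩)

theorem models_system_iff (hp : 4 ≤ p) {E : List Edge} (hE : Bounded E m k) (n : ℕ) :
    (system E p m k n).Models K (reach p) ↔
      ∃ w, ReflTransGen (EStep E) (1, fun _ => (n : K)) (0, w) := by
  rw [models_reach_iff]
  simp only [reachable_iff hp hE]
  constructor
  · rintro ⟨_, ⟨ℓ, w, h, rfl⟩, hq⟩
    rw [holdsAtInst_state hp] at hq
    exact ⟨w, hq ▸ h⟩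
  · rintro ⟨w, h⟩
    exact ⟨_, ⟨0, w, h, rfl⟩, (holdsAtInst_state hp).2 rfl⟩

/-! ### State bound and syntactic restrictions -/

theorem stateBounded_system (hp : 4 ≤ p) {E : List Edge} (hE : Bounded E m k) (n : ℕ) :
    (system E p m k n).StateBounded K (k + 2) := by
  intro s hs a D hD
  obtain ⟨ℓ, w, -, rfl⟩ := (reachable_iff hp hE).1 hs
  obtain rfl : a = instName := state_ne_none.1 (by rw [hD]; simp)
  rw [state_instName, Option.some_inj] at hD
  exact hD ▸ adom_db_encard_le ℓ w

theorem singleAgent_system (hp : 4 ≤ p) {E : List Edge} (hE : Bounded E m k) (n : ℕ) :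
    (system E p m k n).SingleAgent K := by
  refine ⟨rfl, fun s hs => ?_⟩
  obtain ⟨ℓ, w, -, rfl⟩ := (reachable_iff hp hE).1 hs
  exact ⟨fun a => state_ne_none, curAS_state hp ℓ w⟩

theorem shallowTyped_system (E : List Edge) (n : ℕ) : (system E p m k n).ShallowTyped := by
  intro F hF
  have hF : F ∈ [AF, BF, numFacet] := hF
  simp only [List.mem_cons, List.not_mem_nil, or_false] at hF
  rcases hF with rfl | rfl | rfl <;> rfl

theorem mem_schema {r : RelSchema} : r ∈ schema p m k ↔
    (r = ⟨rMyName, [AF]⟩ ∨ r = ⟨rAgent, [AF]⟩ ∨ r = ⟨rSpec, [BF]⟩ ∨ r = ⟨rHasSpec, [AF, BF]⟩) ∨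
      (∃ ℓ < m, ⟨pcRel p ℓ, []⟩ = r) ∨ ∃ i < k, ⟨regRel p i, [numFacet]⟩ = r := by
  simp [schema, or_assoc]

theorem unaryOnly_system (E : List Edge) (n : ℕ) : (system E p m k n).UnaryOnly := by
  constructor
  · intro r hr hn
    rcases mem_schema.1 hr with (rfl | rfl | rfl | rfl) | ⟨ℓ, -, rfl⟩ | ⟨i, -, rfl⟩
    · exact le_rfl
    · exact le_rfl
    · exact le_rfl
    · exact absurd rfl hn
    · exact Nat.zero_le _
    · exact le_rfl
  · intro M hM
    obtain ⟨i, -, rfl⟩ := List.mem_map.1 hM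
    exact Nat.zero_le _

theorem prop_mem_schema {E : List Edge} (hE : Bounded E m k) (n : ℕ) :
    (⟨p, []⟩ : RelSchema) ∈ (system E p m k n).inst.schema :=
  mem_schema.2 (.inr (.inl ⟨0, by have := hE.1; omega, rfl⟩))

end RegisterProgram

/-! # Well-formedness and effectiveness of the construction -/

namespace RegisterProgram

open Rmas Relation

variable {p m k : ℕ}

theorem nodup_schema (hp : 4 ≤ p) : ((schema p m k).map RelSchema.name).Nodup := by
  have h1 : (schema p m k).map RelSchema.name =
      [0, 1, 2, 3] ++ ((List.range m).map (pcRel p) ++ (List.range k).map (regRel p)) := by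
    simp [schema, Function.comp_def, rMyName, rAgent, rSpec, rHasSpec]
  rw [h1, List.nodup_append', List.nodup_append']
  refine ⟨by decide, ⟨List.nodup_range.map fun a b h => pcRel_inj.1 h,
    List.nodup_range.map fun a b h => regRel_inj.1 h, ?_⟩, ?_⟩
  · intro x hx hy
    obtain ⟨a, -, rfl⟩ := List.mem_map.1 hx
    obtain ⟨b, -, h⟩ := List.mem_map.1 hy
    exact regRel_ne_pcRel p a b h
  · intro x hx hy
    have hx : x < 4 := by
      simp only [List.mem_cons, List.not_mem_nil, or_false] at hx
      omega
    rcases List.mem_append.1 hy with h | h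
    · obtain ⟨a, -, rfl⟩ := List.mem_map.1 h
      have := le_pcRel p a
      omega
    · obtain ⟨a, -, rfl⟩ := List.mem_map.1 h
      have := le_regRel p a
      omega

theorem mem_initDom {E : List Edge} {n : ℕ} {c : Const} : c ∈ (system E p m k n).initDom ↔
    c = .agent instName ∨ c = .spec ispecName ∨ c = .num 0 ∨ c = .num n := by
  simp [system]

theorem fits_var {Δ₀ : List Const} {F : Facet} {x : Var} (h : x.ty = F.ty) :
    Term.Fits Δ₀ F (.var x) := ⟨h, fun _ h => by cases h⟩

theorem fv_guard (ins : Instr) : (ins.guard p).fv = ∅ := by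
  cases ins with
  | havoc i => rfl
  | isZero i => simp [Instr.guard, Query.fv]
  | test r i j =>
    ext x
    simp only [Instr.guard, Query.fv, Set.mem_sdiff, Set.mem_union, Set.mem_ofPred_eq,
      List.mem_singleton, Term.var.injEq, Set.mem_singleton_iff, Set.mem_empty_iff_false,
      iff_false]
    rintro ⟨⟨(h | h) | h | h, h2⟩, h1⟩
    · exact h1 h
    · exact h2 h
    · exact h1 h.symm
    · exact h2 h.symm

theorem compatible_guard (E : List Edge) (n : ℕ) {ins : Instr} (h : ins.Below k) :
    (ins.guard p).Compatible (system E p m k n).initDom (schema p m k) := by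
  have hreg : ∀ i < k, (⟨regRel p i, [numFacet]⟩ : RelSchema) ∈ schema p m k :=
    fun i hi => mem_schema.2 (.inr (.inr ⟨i, hi, rfl⟩))
  cases ins with
  | havoc i => trivial
  | test r i j =>
    refine ⟨⟨⟨_, hreg i h.1, rfl, .cons (fits_var rfl) .nil⟩,
      ⟨_, hreg j h.2, rfl, .cons (fits_var rfl) .nil⟩⟩, rfl, ?_, ?_⟩
    · cases r <;> simp [DRel.On, Term.ty, Var.ty]
    · rintro c (h | h) <;> cases h
  | isZero i =>
    refine ⟨_, hreg i h, rfl, .cons ⟨rfl, ?_⟩ .nil⟩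
    rintro c h
    cases h
    exact mem_initDom.2 (.inr (.inr (.inl rfl)))

variable {K : Type*} [Ring K] [LinearOrder K]

/-- The query is domain independent because its only free variable, the target, is bound by the
`Agent` atom, and the guard is covered by `satIn_guard`. -/
theorem wfComm {E : List Edge} (n : ℕ) (hE : Bounded E m k) {e : Edge} {i : ℕ}
    (he : (e, i) ∈ E.zipIdx) : (system E p m k n).WfComm K (instSpec E p m k n) (e.comm p i) := by
  have heE := List.fst_mem_of_mem_zipIdx he
  have hfv : (e.comm p i).query.fv = {.agent 0} := by
    ext x
    simp only [Edge.comm, Query.fv, fv_guard]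
    simp
  refine ⟨⟨⟨⟨rAgent, [AF]⟩, mem_schema.2 (by simp), rfl, .cons (fits_var rfl) .nil⟩,
    ⟨⟨pcRel p e.src, []⟩, mem_schema.2 (.inr (.inl ⟨_, (hE.2 e heE).1, rfl⟩)), rfl, .nil⟩,
    compatible_guard E n (hE.2 e heE).2.2⟩, ?_, ?_, rfl, ⟨i, []⟩, ?_, rfl, .nil⟩
  · intro D _ _ U hU _ v _
    rw [hfv]
    constructor
    · rintro ⟨h1, h2, h3⟩
      refine ⟨?_, h1, h2, (satIn_guard hU v).2 h3⟩
      rintro x rfl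
      exact hU ⟨_, h1, by simp [Term.eval]⟩
    · rintro ⟨-, h1, h2, h3⟩
      exact ⟨h1, h2, (satIn_guard hU v).1 h3⟩
  · rw [hfv]
    ext x
    simp [Edge.comm]
  · have := List.snd_lt_of_mem_zipIdx he
    simpa [system, Edge.comm] using this

theorem wfAction {E : List Edge} (n : ℕ) (hE : Bounded E m k) {e : Edge} {i : ℕ}
    (he : e ∈ E) : (system E p m k n).WfAction K (instSpec E p m k n) (e.action p i) := by
  obtain ⟨hsrc, hdst, hk⟩ := hE.2 e he
  refine ⟨List.nodup_nil, fun q hq => (by cases hq), fun f hf => ?_⟩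
  rcases List.mem_cons.1 hf with rfl | hf
  · refine ⟨trivial, ?_, ?_, ?_⟩
    · intro D _ _ U _ _ v _
      simp [Query.Sat, Query.SatIn, Query.fv]
    · intro d hd
      rw [List.mem_singleton.1 hd]
      exact ⟨⟨⟨pcRel p e.src, []⟩, mem_schema.2 (.inr (.inl ⟨_, hsrc, rfl⟩)), rfl, .nil⟩,
        by simp⟩
    · intro d hd
      rw [List.mem_singleton.1 hd]
      exact ⟨⟨⟨pcRel p e.dst, []⟩, mem_schema.2 (.inr (.inl ⟨_, hdst, rfl⟩)), rfl, .nil⟩,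
        by simp⟩
  · cases h : e.instr with
    | havoc j =>
      rw [h] at hf hk
      rw [List.mem_singleton.1 hf]
      have hj : (⟨regRel p j, [numFacet]⟩ : RelSchema) ∈ schema p m k :=
        mem_schema.2 (.inr (.inr ⟨j, hk, rfl⟩))
      refine ⟨⟨_, hj, rfl, .cons (fits_var rfl) .nil⟩, ?_, ?_, ?_⟩
      · intro D _ _ U hU _ v _
        refine ⟨fun h => ⟨?_, h⟩, fun h => h.2⟩
        intro x hx
        have hx : x = .num 0 := by simpa [Query.fv] using hx
        exact hU ⟨_, h, by simp [hx, Term.eval]⟩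
      · intro d hd
        rw [List.mem_singleton.1 hd]
        exact ⟨⟨_, hj, rfl, .cons (fits_var rfl) .nil⟩, fun x hx => .inl hx⟩
      · intro d hd
        rw [List.mem_singleton.1 hd]
        refine ⟨⟨_, hj, rfl, .cons ⟨⟨0, [], numFacet⟩, by simp [system], rfl, .nil, rfl⟩ .nil⟩, ?_⟩
        intro x hx
        simp at hx
    | test r a b => rw [h] at hf; cases hf
    | isZero a => rw [h] at hf; cases hf

theorem wfUpdate {E : List Edge} (n : ℕ) {i : ℕ} (hi : i < E.length) :
    (system E p m k n).WfUpdate (instSpec E p m k n) (update i) := by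
  refine ⟨by simp [update], rfl, ⟨⟨i, []⟩, by simpa [system] using hi, rfl, .nil⟩, trivial,
    (fun x hx => by cases hx), ⟨(E[i]).action p i, ?_, rfl, .nil⟩, fun x hx => by cases hx⟩
  exact List.mem_map.2 ⟨(E[i], i), List.mk_mem_zipIdx_iff_getElem?.2 (by simp), rfl⟩

theorem wfSpec (hp : 4 ≤ p) {E : List Edge} (n : ℕ) (hE : Bounded E m k) :
    (system E p m k n).WfSpec K (instSpec E p m k n) := by
  refine ⟨mem_initDom.2 (.inr (.inl rfl)), ⟨nodup_schema hp, ?_⟩, mem_schema.2 (by simp),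
    fun q hq => (by cases hq), ?_, fun q hq => (by cases hq), ?_, ?_, ?_, ?_, ?_⟩
  · intro r hr F hF
    rcases mem_schema.1 hr with (rfl | rfl | rfl | rfl) | ⟨ℓ, -, rfl⟩ | ⟨i, -, rfl⟩ <;>
      simp at hF <;> simp [system, hF]
    rcases hF with rfl | rfl <;> simp
  · rw [initial_instSpec]
    exact conforms_db hE.1 _
  · intro f hf c hc
    rw [mem_initDom]
    rcases List.mem_append.1 hf with hf | hf
    · simp only [List.mem_cons, List.not_mem_nil, or_false] at hf
      rcases hf with rfl | rfl | rfl | rfl | rfl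
      · simp_all
      · simp_all
      · simp_all
      · have : c = .agent instName ∨ c = .spec ispecName := by simpa using hc
        rcases this with rfl | rfl <;> simp
      · simp at hc
    · obtain ⟨i, -, rfl⟩ := List.mem_map.1 hf
      simp_all
  · intro c hc
    obtain ⟨⟨e, i⟩, he, rfl⟩ := List.mem_map.1 hc
    exact wfComm n hE he
  · have : (instSpec E p m k n).actions.map Action.name = List.range E.length := by
      simp only [instSpec, List.map_map, Function.comp_def, Edge.action]
      rw [List.range_eq_range']
      exact List.zipIdx_map_snd 0 E
    rw [this]
    exact List.nodup_range
  · intro α hα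
    obtain ⟨⟨e, i⟩, he, rfl⟩ := List.mem_map.1 hα
    exact wfAction n hE (List.fst_mem_of_mem_zipIdx he)
  · intro u hu
    obtain ⟨i, hi, rfl⟩ := List.mem_map.1 hu
    exact wfUpdate n (List.mem_range.1 hi)

theorem wellFormed_system (hp : 4 ≤ p) {E : List Edge} (n : ℕ) (hE : Bounded E m k) :
    (system E p m k n).WellFormed K := by
  have hspecs : ∀ S ∈ (system E p m k n).allSpecs, S = instSpec E p m k n := by
    simp [RMAS.allSpecs, system]
  refine ⟨?_, by simp [system], by simp [system], ⟨?_, ?_⟩, by simp [RMAS.allSpecs, system],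
    fun S hS => hspecs S hS ▸ wfSpec hp n hE, rfl, mem_schema.2 (by simp),
    mem_schema.2 (by simp), mem_schema.2 (by simp), ?_, ?_, ?_⟩
  · intro F hF
    rw [shallowTyped_system E n F hF]
    trivial
  · simp [system, Function.comp_def, List.nodup_range]
  · intro M hM F hF
    obtain ⟨i, -, rfl⟩ := List.mem_map.1 hM
    cases hF
  · simp [system, instSpec, initDb]
  · intro S hS
    rw [hspecs S hS]
    simp [system, instSpec, initDb]
  · simp [system, instSpec, initDb]

/-! ### The reduction is primitive recursive -/

theorem primrec_constNum : Primrec fun n : ℕ => (.num n : Const) := by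
  rw [← Primrec.encode_iff]
  -- Numbers are the second summand of a second summand, each of which contributes `2 * _ + 1`; a
  -- natural number `n` has the code `2 * n` as an integer.
  have : ∀ n : ℕ, Encodable.encode (.num n : Const) = 2 * (2 * (2 * n) + 1) + 1 := fun n => rfl
  simp only [this]
  have h2 : Primrec fun n : ℕ => 2 * n := Primrec.nat_mul.comp (.const 2) .id
  exact Primrec.succ.comp (h2.comp (Primrec.succ.comp (h2.comp h2)))

theorem primrec_initDb (p k : ℕ) : Primrec (initDb p k) := by
  refine Primrec.list_append.comp (.const _) (Primrec.list_map (.const _) ?_)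
  have h : Primrec fun i => regRel p i :=
    Primrec.nat_add.comp (Primrec.nat_add.comp (.const p)
      (Primrec.nat_mul.comp (.const 2) .id)) (.const 5)
  exact (h.comp .snd).pair (Primrec.list_cons.comp (primrec_constNum.comp .fst) (.const []))

/-- The coding of specifications is that of tuples, and only the component `initDb` depends on the
input. -/
theorem primrec_instSpec (E : List Edge) (p m k : ℕ) : Primrec (instSpec E p m k) := by
  have h : Primrec fun n => (ispecName, schema p m k, ([] : List Query), initDb p k n,
      E.zipIdx.map (fun x => x.1.comm p x.2), E.zipIdx.map (fun x => x.1.action p x.2),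
      (List.range E.length).map update) :=
    (Primrec.const _).pair ((Primrec.const _).pair ((Primrec.const _).pair
      ((primrec_initDb p k).pair (Primrec.const _))))
  rw [← Primrec.encode_iff] at h ⊢
  exact h

theorem primrec_system (E : List Edge) (p m k : ℕ) : Primrec (system E p m k) := by
  have hdom : Primrec fun n : ℕ => ([.agent instName, .spec ispecName, .num 0, .num n] :
      List Const) :=
    Primrec.list_cons.comp (.const _) (Primrec.list_cons.comp (.const _)
      (Primrec.list_cons.comp (.const _) (Primrec.list_cons.comp primrec_constNum (.const []))))
  have h : Primrec fun n : ℕ => ([AF, BF, numFacet],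
      ([.agent instName, .spec ispecName, .num 0, .num n] : List Const),
      ([⟨0, [], numFacet⟩] : List Service),
      (List.range E.length).map (fun i => (⟨i, []⟩ : RelSchema)), ([] : List AgentSpec),
      instSpec E p m k n) :=
    (Primrec.const _).pair (hdom.pair ((Primrec.const _).pair ((Primrec.const _).pair
      ((Primrec.const _).pair (primrec_instSpec E p m k)))))
  rw [← Primrec.encode_iff] at h ⊢
  exact h

end RegisterProgram

/-! ### Reduction from the halting problem -/

theorem theorem3 (K : Type*) [Ring K] [LinearOrder K] [IsStrictOrderedRing K] (p : ℕ)
    (hp : p ∉ ({Rmas.rMyName, Rmas.rAgent, Rmas.rSpec, Rmas.rHasSpec} : Set ℕ)) :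
    ¬ Rmas.DecidableOn
      {I : RMAS × ℕ | I.1.WellFormed K ∧ I.1.StateBounded K I.2 ∧ I.1.ShallowTyped ∧
        I.1.SingleAgent K ∧ I.1.UnaryOnly ∧ (⟨p, []⟩ : Rmas.RelSchema) ∈ I.1.inst.schema}
      (fun I => I.1.Models K (Rmas.reach p)) := by
  have hp4 : 4 ≤ p := by
    simp only [Rmas.rMyName, Rmas.rAgent, Rmas.rSpec, Rmas.rHasSpec, Set.mem_insert_iff,
      Set.mem_singleton_iff] at hp
    omega
  rintro ⟨f, hf, hdec⟩
  -- The universal function with its argument fixed to `0`: one program serves all codes, so `E`,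
  -- `m` and `k` do not depend on the instance.
  let halts : ℕ →. ℕ := fun a => (Denumerable.ofNat Nat.Partrec.Code a).eval 0
  have hh : Nat.Partrec halts := Partrec.nat_iff.1
    (Nat.Partrec.Code.eval_part.comp (Computable.ofNat _) (Computable.const 0))
  obtain ⟨E, hE⟩ := RegisterProgram.exists_program_of_partrec (K := K) hh
  obtain ⟨m, k, hb⟩ := RegisterProgram.exists_bounded E
  -- The constructed systems satisfy all the restrictions, so on them the partial algorithm `f`
  -- terminates with the right answer.
  have hval : ∀ c : Nat.Partrec.Code, ∃ b : Bool,
      b ∈ f (RegisterProgram.system E p m k (Encodable.encode c), k + 2) ∧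
        (b = true ↔ (c.eval 0).Dom) := by
    intro c
    obtain ⟨b, hb1, hb2⟩ := hdec
      (RegisterProgram.system E p m k (Encodable.encode c), k + 2)
      ⟨RegisterProgram.wellFormed_system hp4 _ hb, RegisterProgram.stateBounded_system hp4 hb _,
        RegisterProgram.shallowTyped_system E _, RegisterProgram.singleAgent_system hp4 hb _,
        RegisterProgram.unaryOnly_system E _, RegisterProgram.prop_mem_schema hb _⟩
    refine ⟨b, hb1, hb2.trans ((RegisterProgram.models_system_iff hp4 hb _).trans
      ((hE (Encodable.encode c) _ rfl).trans ?_))⟩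
    simp only [halts, Denumerable.ofNat_encode]
  choose g hg hg' using hval
  refine ComputablePred.halting_problem 0 (ComputablePred.computable_iff.2 ⟨g, ?_, ?_⟩)
  -- The composite of `f` with the reduction is partial recursive and total on codes, so its values
  -- `g` are computable.
  · refine (hf.comp (((RegisterProgram.primrec_system E p m k).to_comp.comp
      Computable.encode).pair (Computable.const (k + 2)))).of_eq fun c => ?_
    exact Part.eq_some_iff.2 (hg c)
  · exact funext fun c => propext (hg' c).symm
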